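/- Work in classical first-order logic with equality in the language $\{\in\}$; $\langle x,y\rangle$ denotes the Kuratowski pair $\{\{x\},\{x,y\}\}$. Let $\mathbf{B}$ be the theory with the axioms: Extensionality; Pair; Union; Infinity (there exists a limit ordinal); $\Delta_0$ Separation; Regularity; Transitive Closure (every set has a transitive closure); Finite Powerset (for every set $x$ there is a set $\{y\subseteq x : |y|<\omega\}$). Let $\mathbf{C}$ be $\mathbf{B}$ together with Axiom Beta: for every well founded relation $R$ on a set $X$ there exist a transitive set $Y$ and a function $\pi:X\to Y$ such that $\pi(u)=\{\pi(v): v\in X\wedge\langle v,u\rangle\in R\}$ for all $u\in X$. Here a relation $R\subseteq X\times X$ is well founded if every nonempty $Z\subseteq X$ has an element $m$ such that $\langle z,m\rangle\in R$ for no $z\in Z$. For a relation $\prec$ on $X$ (not necessarily transitive), a set $H\subseteq a\times X$ and $s\in X$, write $H_s=\{u\in a:\langle u,s\rangle\in H\}$ and $H_{\prec s}=\bigcup_{t\prec s}(H_t\times\{t\})$. Theorem. Let $\psi(u,v,x_0,\dots,x_n)$ be a $\Delta_0$ formula with the displayed free variables, in which the variable $v$ occurs only in atomic formulas of the form $x\in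 v$, with $x$ a variable other than $v$ (these may be negated, and may be the bounds of bounded quantifiers). Then $\mathbf{C}$ proves $\psi$-$\mathbf{TR}$, that is, the statement: for all sets $a,p_0,\dots,p_n$ and every well founded relation $\langle X,\prec\rangle$ there is a set $H\subseteq a\times X$ such that $$\forall s\in X\;\forall c\in a\;\bigl(c\in H_s\leftrightarrow\psi[c,H_{\prec s},p_0,\dots,p_n]\bigr).$$ In other words, $\mathbf{C}\vdash\Delta_0\text{-}\mathbf{TR}$. -/

import Mathlib

/-! First-order logic with equality in the language `{∈}` of set theory: syntax, derivations,
the theory `C`, and the scheme of `Δ₀` transfinite recursion. -/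

namespace SetTh

/-- First-order formulas in the language of set theory with equality, in de Bruijn style.
The variables are the natural numbers. In `all φ` the quantifier binds the variable `0` of `φ`,
and the variable `i + 1` of `φ` denotes the variable `i` of `all φ`. -/
inductive Fml : Type
  | mem (i j : ℕ) : Fml
  | eq (i j : ℕ) : Fml
  | bot : Fml
  | imp (φ ψ : Fml) : Fml
  | all (φ : Fml) : Fml

namespace Fml

/-! ### Classical connectives and quantifiers -/

def neg (φ : Fml) : Fml := imp φ bot

def conj (φ ψ : Fml) : Fml := neg (imp φ (neg ψ))

def disj (φ ψ : Fml) : Fml := imp (neg φ) ψ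

def biimp (φ ψ : Fml) : Fml := conj (imp φ ψ) (imp ψ φ)

def ex (φ : Fml) : Fml := neg (all (neg φ))

/-- The bounded quantifier `∀ z ∈ y, φ`; the bound variable `z` is the variable `0` of `φ`. -/
def allIn (y : ℕ) (φ : Fml) : Fml := all (imp (mem 0 (y + 1)) φ)

/-- The bounded quantifier `∃ z ∈ y, φ`; the bound variable `z` is the variable `0` of `φ`. -/
def exIn (y : ℕ) (φ : Fml) : Fml := ex (conj (mem 0 (y + 1)) φ)

/-! ### Renaming of free variables and universal closure -/

/-- The action of a renaming `ρ` below a quantifier. -/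
def liftRen (ρ : ℕ → ℕ) : ℕ → ℕ
  | 0 => 0
  | i + 1 => ρ i + 1

/-- The (capture avoiding) renaming of the free variables of a formula along `ρ`. -/
def rename : (ℕ → ℕ) → Fml → Fml
  | ρ, mem i j => mem (ρ i) (ρ j)
  | ρ, eq i j => eq (ρ i) (ρ j)
  | _, bot => bot
  | ρ, imp φ ψ => imp (rename ρ φ) (rename ρ ψ)
  | ρ, all φ => all (rename (liftRen ρ) φ)

/-- The instance `φ(t)` of the matrix `φ` of `all φ`. -/
def inst (t : ℕ) (φ : Fml) : Fml :=
  rename (fun i => match i with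
    | 0 => t
    | k + 1 => k) φ

/-- A number above every free variable of the formula. -/
def fvBound : Fml → ℕ
  | mem i j => max (i + 1) (j + 1)
  | eq i j => max (i + 1) (j + 1)
  | bot => 0
  | imp φ ψ => max (fvBound φ) (fvBound ψ)
  | all φ => fvBound φ - 1

/-- The universal closure of a formula. -/
def univClosure (φ : Fml) : Fml := all^[fvBound φ] φ

/-! ### Syntactic classes of formulas -/

/-- The `Δ₀` formulas: every quantifier is bounded. -/
inductive IsDelta0 : Fml → Prop
  | mem (i j : ℕ) : IsDelta0 (mem i j)
  | eq (i j : ℕ) : IsDelta0 (eq i j)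
  | bot : IsDelta0 bot
  | imp {φ ψ : Fml} : IsDelta0 φ → IsDelta0 ψ → IsDelta0 (imp φ ψ)
  | allIn (y : ℕ) {φ : Fml} : IsDelta0 φ → IsDelta0 (allIn y φ)
  | exIn (y : ℕ) {φ : Fml} : IsDelta0 φ → IsDelta0 (exIn y φ)

/-- The free variable `v` occurs only in atomic formulas of the form `x ∈ v`,
where `x` is a variable other than `v`. -/
def OnlyAsClass : ℕ → Fml → Prop
  | v, mem i _ => i ≠ v
  | v, eq i j => i ≠ v ∧ j ≠ v
  | _, bot => True
  | v, imp φ ψ => OnlyAsClass v φ ∧ OnlyAsClass v ψ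
  | v, all φ => OnlyAsClass (v + 1) φ

end Fml

open Fml

/-- `Derives Γ φ`: the formula `φ` is derivable from the set `Γ` of formulas in natural deduction
for classical first-order logic with equality. In `allI` all hypotheses are shifted, so that the
eigenvariable `0` is not free in them. -/
inductive Derives : Set Fml → Fml → Prop
  | hyp {Γ : Set Fml} {φ : Fml} : φ ∈ Γ → Derives Γ φ
  | impI {Γ : Set Fml} {φ ψ : Fml} : Derives (insert φ Γ) ψ → Derives Γ (imp φ ψ)
  | impE {Γ : Set Fml} {φ ψ : Fml} : Derives Γ (imp φ ψ) → Derives Γ φ → Derives Γ ψ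
  | raa {Γ : Set Fml} {φ : Fml} : Derives (insert (neg φ) Γ) bot → Derives Γ φ
  | allI {Γ : Set Fml} {φ : Fml} : Derives (rename Nat.succ '' Γ) φ → Derives Γ (all φ)
  | allE {Γ : Set Fml} {φ : Fml} (t : ℕ) : Derives Γ (all φ) → Derives Γ (inst t φ)
  | eqRefl {Γ : Set Fml} (t : ℕ) : Derives Γ (eq t t)
  | eqE {Γ : Set Fml} (φ : Fml) {s t : ℕ} :
      Derives Γ (eq s t) → Derives Γ (inst s φ) → Derives Γ (inst t φ)

namespace Fml

/-! ### Set-theoretic notions as formulas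

The arguments are the (free) variables that the notion speaks about. -/

/-- `x ⊆ y` -/
def subset (x y : ℕ) : Fml := allIn x (mem 0 (y + 1))

/-- `z = {x, y}` -/
def isUPair (z x y : ℕ) : Fml :=
  all (biimp (mem 0 (z + 1)) (disj (eq 0 (x + 1)) (eq 0 (y + 1))))

/-- `p = ⟨x, y⟩`, the Kuratowski pair `{{x}, {x, y}}` -/
def isPair (p x y : ℕ) : Fml :=
  all (biimp (mem 0 (p + 1)) (disj (isUPair 0 (x + 1) (x + 1)) (isUPair 0 (x + 1) (y + 1))))

/-- `⟨x, y⟩ ∈ r` -/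
def pairMem (x y r : ℕ) : Fml := ex (conj (isPair 0 (x + 1) (y + 1)) (mem 0 (r + 1)))

/-- `x` is transitive. -/
def isTransitive (x : ℕ) : Fml := allIn x (subset 0 (x + 1))

/-- `x` is an ordinal: a transitive set of transitive sets. -/
def isOrd (x : ℕ) : Fml := conj (isTransitive x) (allIn x (isTransitive 0))

/-- `x` is a limit ordinal: a nonempty ordinal without a largest element. -/
def isLimit (x : ℕ) : Fml :=
  conj (isOrd x) (conj (ex (mem 0 (x + 1))) (allIn x (exIn (x + 1) (mem 1 0))))

/-- `x` is empty or `x = y ∪ {y}` for some `y`. -/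
def isZeroOrSucc (x : ℕ) : Fml :=
  disj (all (neg (mem 0 (x + 1))))
    (ex (all (biimp (mem 0 (x + 2)) (disj (mem 0 1) (eq 0 1)))))

/-- `x` is a natural number: an ordinal that is, with all its elements, zero or a successor. -/
def isNat (x : ℕ) : Fml := conj (isOrd x) (conj (isZeroOrSucc x) (allIn x (isZeroOrSucc 0)))

/-- `r ⊆ x × y` -/
def isRel (r x y : ℕ) : Fml := allIn r (exIn (x + 1) (exIn (y + 2) (isPair 2 1 0)))

/-- `f` is a function from `x` to `y`. -/
def isFun (f x y : ℕ) : Fml :=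
  conj (isRel f x y) (allIn x (ex (all (biimp (pairMem 2 0 (f + 3)) (eq 0 1)))))

/-- `f` is a bijection from `x` to `y`. -/
def isBij (f x y : ℕ) : Fml :=
  conj (isFun f x y) (allIn y (ex (all (biimp (pairMem 0 2 (f + 3)) (eq 0 1)))))

/-- `|y| < ω`: some natural number is in bijection with `y`. -/
def isFinite (y : ℕ) : Fml := ex (conj (isNat 0) (ex (isBij 0 (y + 2) 1)))

/-- `r` is a well founded relation on `x`: `r ⊆ x × x`, and every nonempty `y ⊆ x` has an element
`m` such that `⟨z, m⟩ ∈ r` for no `z ∈ y`. -/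
def isWF (x r : ℕ) : Fml :=
  conj (isRel r x x)
    (all (imp (conj (subset 0 (x + 1)) (ex (mem 0 1)))
      (exIn 0 (allIn 1 (neg (pairMem 0 1 (r + 3)))))))

/-! ### The axioms -/

def axExtensionality : Fml :=
  all (all (imp (all (biimp (mem 0 2) (mem 0 1))) (eq 1 0)))

def axPair : Fml := all (all (ex (isUPair 0 2 1)))

def axUnion : Fml := all (ex (all (biimp (mem 0 1) (exIn 2 (mem 1 0)))))

def axInfinity : Fml := ex (isLimit 0)

/-- Separation for `φ`: `∀ p⃗ ∀ a ∃ b ∀ x (x ∈ b ↔ x ∈ a ∧ φ(x, p⃗))`. Here `x` is the variable `0`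
of `φ`, and the other free variables of `φ` are the parameters `p⃗`. -/
def axSeparation (φ : Fml) : Fml :=
  univClosure (all (ex (all (biimp (mem 0 1) (conj (mem 0 2)
    (rename (fun i => match i with
      | 0 => 0
      | k + 1 => k + 3) φ))))))

def axRegularity : Fml :=
  all (imp (ex (mem 0 1)) (exIn 0 (allIn 1 (neg (mem 0 1)))))

/-- Every set `x` has a transitive closure: a least transitive set `y ⊇ x`. -/
def axTransitiveClosure : Fml :=
  all (ex (conj (conj (isTransitive 0) (subset 1 0))
    (all (imp (conj (isTransitive 0) (subset 2 0)) (subset 1 0)))))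

/-- For every `x` the set of all finite `y ⊆ x` exists. -/
def axFinitePowerset : Fml :=
  all (ex (all (biimp (mem 0 1) (conj (subset 0 2) (isFinite 0)))))

/-- For every well founded relation `R` on a set `X` there are a transitive set `Y` and a function
`π : X → Y` such that `π(u) = {π(v) : v ∈ X ∧ ⟨v, u⟩ ∈ R}` for every `u ∈ X`. -/
def axBeta : Fml :=
  -- `X, R`
  all (all (imp (isWF 1 0)
    -- `Y, π`
    (ex (ex (conj (isTransitive 1) (conj (isFun 0 3 1)
      -- for `u ∈ X` and `y = π(u)`
      (allIn 3 (all (imp (pairMem 1 0 2)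
        -- for every `w`: `w ∈ y` iff there is `v ∈ X` with `⟨v, u⟩ ∈ R` and `w = π(v)`
        (all (biimp (mem 0 1) (exIn 6 (conj (pairMem 0 3 6) (pairMem 0 1 4))))))))))))))

/-! ### Transfinite recursion -/

/-- `w = H_{≺ s}`, that is `w = ⋃_{t ≺ s} (H_t × {t})`, where `r` is the relation `≺` and
`H_t = {u ∈ a : ⟨u, t⟩ ∈ H}`: for every `p`, `p ∈ w` iff there are `t` with `⟨t, s⟩ ∈ r` and
`u ∈ a` with `⟨u, t⟩ ∈ H` and `p = ⟨u, t⟩`. -/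
def isBelow (w a r h s : ℕ) : Fml :=
  all (biimp (mem 0 (w + 1)) (ex (conj (pairMem 0 (s + 2) (r + 2))
    (exIn (a + 2) (conj (pairMem 0 1 (h + 3)) (isPair 2 0 1))))))

/-- The statement `ψ-TR`. The variables `0`, `1`, `i + 2` of `ψ` are `u`, `v` and the parameter
`p_i`. For all `p⃗`, all sets `a` and all well founded relations `⟨X, ≺⟩` there is `H ⊆ a × X` such
that for all `s ∈ X` and `c ∈ a`: `c ∈ H_s` (that is, `⟨c, s⟩ ∈ H`) iff `ψ[c, H_{≺ s}, p⃗]`. The set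
`w = H_{≺ s}`, which is unique by Extensionality, is asserted to exist. -/
def transRec (ψ : Fml) : Fml :=
  -- `a, X, ≺`
  univClosure (all (all (all (imp (isWF 1 0)
    -- `H`
    (ex (conj (isRel 0 3 2)
      -- `s ∈ X, c ∈ a`
      (allIn 2 (allIn 4
        -- `w = H_{≺ s}`
        (ex (conj (isBelow 0 6 4 3 2) (biimp (pairMem 1 2 3)
          (rename (fun i => match i with
            | 0 => 1
            | 1 => 0
            | k + 2 => k + 7) ψ))))))))))))

end Fml

/-- The theory `B`. -/
def theoryB : Set Fml :=
  {axExtensionality, axPair, axUnion, axInfinity, axRegularity, axTransitiveClosure,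
    axFinitePowerset} ∪ {χ | ∃ φ : Fml, IsDelta0 φ ∧ χ = axSeparation φ}

/-- The theory `C`, that is `B` with Axiom Beta. -/
def theoryC : Set Fml := theoryB ∪ {axBeta}

/-- The scheme `Δ₀-TR`: all statements `ψ-TR`, where `ψ` is a `Δ₀` formula in which the variable `v`
(the variable `1`) occurs only in atomic formulas of the form `x ∈ v`. -/
def delta0TR : Set Fml :=
  {χ | ∃ ψ : Fml, IsDelta0 ψ ∧ OnlyAsClass 1 ψ ∧ χ = transRec ψ}

end SetTh

/-! By the completeness theorem it suffices to find `H` inside an arbitrary model of `C`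
(`exists_recursion`). There well foundedness is internal, so every induction must be run on a set,
and sets come from `Δ₀` Separation. The only recursion at hand is that of Axiom Beta, which merely
collects the values below a point. The idea is to make it compute truth values, coded as equalities
between collapsed sets.

Consider a well founded game whose positions are conjunctions or disjunctions of the positions below
them. To each position `n` attach two sets `x_n`, `y_n`, so that `x_n = y_n` exactly when `n` is
won. For a conjunction, `x_n` collects all `x_m` and `y_n` all `y_m`, with `m` below `n`. For a
disjunction, let `Q` collect all `x_m`, and let `P_m` be `Q` with `x_m` replaced by `y_m`; then
`y_n` collects all `P_m`, and `x_n` collects these and `Q`. Thus `x_n = y_n` iff `Q` is some `P_m`,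
iff `x_m = y_m` for some `m`. A tag `{∅, n}` in each set prevents accidental coincidences
(`IsGadget.eq_iff`). All these sets arise from one collapse, so the won positions form a set
(`exists_gameValue`).

The recursion is turned into such a game. A position claims that a subformula of `ψ` is true, or
that it is false, at a stage `s` under a finite list of values from a transitive set `D`.
Connectives and quantifiers give the obvious moves. An atom `x ∈ v` with `x = ⟨u, t⟩` and `t ≺ s`
leads to the same claim about `ψ` at stage `t` with first value `u`; this is where the restriction
on `v` enters. The stage drops, or it stays and the formula shrinks, so the game is well founded.
Claims of falsity are separate positions, which avoids negation in the game; induction along `≺`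
shows that they are won exactly when the opposite claims are lost (`evaluation_correct`). Then `H`
consists of the pairs `⟨u, s⟩` for which the truth of `ψ` is a won claim. -/

namespace SetTh

open Fml

/-- The sequence `a, f 0, f 1, …`. -/
def scons {α : Type*} (a : α) (f : ℕ → α) : ℕ → α
  | 0 => a
  | k + 1 => f k

@[simp] theorem scons_zero {α : Type*} (a : α) (f : ℕ → α) : scons a f 0 = a := rfl

@[simp] theorem scons_succ {α : Type*} (a : α) (f : ℕ → α) (k : ℕ) :
    scons a f (k + 1) = f k := rfl

theorem scons_eta {α : Type*} (f : ℕ → α) : scons (f 0) (fun k => f (k + 1)) = f := by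
  funext i; cases i <;> rfl

/-! ### Renaming -/

theorem Fml.rename_congr {φ : Fml} : ∀ {ρ σ : ℕ → ℕ}, (∀ i < fvBound φ, ρ i = σ i) →
    rename ρ φ = rename σ φ := by
  induction φ with
  | mem i j =>
    intro ρ σ h
    simp only [fvBound] at h
    simp only [rename]; rw [h i (by omega), h j (by omega)]
  | eq i j =>
    intro ρ σ h
    simp only [fvBound] at h
    simp only [rename]; rw [h i (by omega), h j (by omega)]
  | bot => intros; rfl
  | imp φ ψ ih1 ih2 =>
    intro ρ σ h
    simp only [fvBound] at h
    simp only [rename]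
    rw [ih1 (fun i hi => h i (by omega)), ih2 (fun i hi => h i (by omega))]
  | all φ ih =>
    intro ρ σ h
    simp only [fvBound] at h
    simp only [rename]
    rw [ih]
    intro i hi
    cases i with
    | zero => rfl
    | succ i => simp only [liftRen]; rw [h i (by omega)]

theorem Fml.rename_rename (φ : Fml) : ∀ (σ ρ : ℕ → ℕ),
    rename σ (rename ρ φ) = rename (fun i => σ (ρ i)) φ := by
  induction φ with
  | mem i j => intros; rfl
  | eq i j => intros; rfl
  | bot => intros; rfl
  | imp φ ψ ih1 ih2 => intro σ ρ; simp only [rename, ih1, ih2]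
  | all φ ih =>
    intro σ ρ
    simp only [rename, ih]
    congr 1
    apply rename_congr
    intro i _
    cases i <;> rfl

theorem Fml.rename_id (φ : Fml) : ∀ {ρ : ℕ → ℕ}, (∀ i < fvBound φ, ρ i = i) →
    rename ρ φ = φ := by
  induction φ with
  | mem i j =>
    intro ρ h
    simp only [fvBound] at h
    simp only [rename]; rw [h i (by omega), h j (by omega)]
  | eq i j =>
    intro ρ h
    simp only [fvBound] at h
    simp only [rename]; rw [h i (by omega), h j (by omega)]
  | bot => intros; rfl
  | imp φ ψ ih1 ih2 =>
    intro ρ h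
    simp only [fvBound] at h
    simp only [rename]
    rw [ih1 (fun i hi => h i (by omega)), ih2 (fun i hi => h i (by omega))]
  | all φ ih =>
    intro ρ h
    simp only [fvBound] at h
    simp only [rename]
    rw [ih]
    intro i hi
    cases i with
    | zero => rfl
    | succ i => simp only [liftRen]; rw [h i (by omega)]

theorem Fml.inst_eq (t : ℕ) (φ : Fml) : inst t φ = rename (scons t id) φ := by
  unfold inst
  apply rename_congr
  intro i _
  cases i <;> rfl

theorem Fml.rename_inst (ρ : ℕ → ℕ) (t : ℕ) (φ : Fml) :
    rename ρ (inst t φ) = inst (ρ t) (rename (liftRen ρ) φ) := by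
  rw [inst_eq, inst_eq, rename_rename, rename_rename]
  apply rename_congr
  intro i _
  cases i <;> rfl

theorem Fml.rename_scons (ρ : ℕ → ℕ) (t : ℕ) (φ : Fml) :
    rename (scons t ρ) φ = inst t (rename (liftRen ρ) φ) := by
  rw [inst_eq, rename_rename]
  apply rename_congr
  intro i _
  cases i <;> rfl

/-! ### Admissible rules -/

theorem Derives.mono {Γ : Set Fml} {φ : Fml} (h : Derives Γ φ) :
    ∀ {Δ : Set Fml}, Γ ⊆ Δ → Derives Δ φ := by
  induction h with
  | hyp h => exact fun hs => .hyp (hs h)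
  | impI _ ih => exact fun hs => .impI (ih (Set.insert_subset_insert hs))
  | impE _ _ ih1 ih2 => exact fun hs => .impE (ih1 hs) (ih2 hs)
  | raa _ ih => exact fun hs => .raa (ih (Set.insert_subset_insert hs))
  | allI _ ih => exact fun hs => .allI (ih (Set.image_mono hs))
  | allE t _ ih => exact fun hs => .allE t (ih hs)
  | eqRefl t => exact fun _ => .eqRefl t
  | eqE φ _ _ ih1 ih2 => exact fun hs => .eqE φ (ih1 hs) (ih2 hs)

theorem Derives.rename {Γ : Set Fml} {φ : Fml} (h : Derives Γ φ) :
    ∀ ρ : ℕ → ℕ, Derives (Fml.rename ρ '' Γ) (Fml.rename ρ φ) := by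
  induction h with
  | hyp h => exact fun ρ => .hyp (Set.mem_image_of_mem _ h)
  | impI _ ih => exact fun ρ => .impI (by rw [← Set.image_insert_eq]; exact ih ρ)
  | impE _ _ ih1 ih2 => exact fun ρ => .impE (ih1 ρ) (ih2 ρ)
  | raa _ ih =>
    intro ρ
    refine .raa ?_
    have := ih ρ
    rw [Set.image_insert_eq] at this
    exact this
  | allI _ ih =>
    intro ρ
    refine .allI ?_
    have := ih (liftRen ρ)
    rw [Set.image_image] at this ⊢
    simp only [rename_rename] at this ⊢
    exact this
  | allE t _ ih =>
    intro ρ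
    rw [rename_inst]
    exact .allE _ (ih ρ)
  | eqRefl t => exact fun ρ => .eqRefl _
  | eqE φ _ _ ih1 ih2 =>
    intro ρ
    rw [rename_inst]
    refine .eqE _ (ih1 ρ) ?_
    rw [← rename_inst]
    exact ih2 ρ

theorem Derives.exFalso {Γ : Set Fml} {φ : Fml} (h : Derives Γ bot) : Derives Γ φ :=
  .raa (h.mono (Set.subset_insert _ _))

theorem Derives.eqSymm {Γ : Set Fml} {s t : ℕ} (h : Derives Γ (eq s t)) : Derives Γ (eq t s) :=
  .eqE (eq 0 (s + 1)) h (.eqRefl s)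

theorem Derives.eqTrans {Γ : Set Fml} {s t u : ℕ} (h : Derives Γ (eq s t))
    (h' : Derives Γ (eq t u)) : Derives Γ (eq s u) :=
  .eqE (eq (s + 1) 0) h' h

theorem Derives.memCongr {Γ : Set Fml} {s t s' t' : ℕ} (hs : Derives Γ (eq s s'))
    (ht : Derives Γ (eq t t')) (h : Derives Γ (mem s t)) : Derives Γ (mem s' t') :=
  .eqE (mem (s' + 1) 0) ht (.eqE (mem 0 (t + 1)) hs h)

/-- Generalization on a fresh variable. -/
theorem Derives.allI_fresh {Γ : Set Fml} {φ : Fml} {y : ℕ} (hΓ : ∀ χ ∈ Γ, fvBound χ ≤ y)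
    (hφ : fvBound φ ≤ y) (h : Derives Γ (inst y φ)) : Derives Γ (all φ) := by
  refine .allI ?_
  -- Sending `y` to `0` and shifting the rest turns `inst y φ` back into `φ`, and `Γ`, where `y` is
  -- not free, into its shift.
  have h1 := h.rename (fun i => if i = y then 0 else i + 1)
  have h2 : Fml.rename (fun i => if i = y then 0 else i + 1) (inst y φ) = φ := by
    rw [inst_eq, rename_rename]
    apply rename_id
    intro i hi
    cases i with
    | zero => simp
    | succ i => exact if_neg (show i ≠ y by omega)
  rw [h2] at h1
  convert h1 using 1
  apply Set.image_congr
  intro χ hχ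
  apply rename_congr
  intro i hi
  have := hΓ χ hχ
  rw [if_neg (by omega)]

/-! ### Semantics -/

/-- Satisfaction in the structure `(M, E)` under the assignment `v`. -/
def Sat {M : Type} (E : M → M → Prop) : (ℕ → M) → Fml → Prop
  | v, mem i j => E (v i) (v j)
  | v, eq i j => v i = v j
  | _, bot => False
  | v, imp φ ψ => Sat E v φ → Sat E v ψ
  | v, all φ => ∀ x, Sat E (scons x v) φ

section Sat

variable {M : Type} {E : M → M → Prop}

theorem Sat.congr {φ : Fml} : ∀ {v w : ℕ → M}, (∀ i < fvBound φ, v i = w i) →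
    (Sat E v φ ↔ Sat E w φ) := by
  induction φ with
  | mem i j =>
    intro v w h
    simp only [fvBound] at h
    simp only [Sat]; rw [h i (by omega), h j (by omega)]
  | eq i j =>
    intro v w h
    simp only [fvBound] at h
    simp only [Sat]; rw [h i (by omega), h j (by omega)]
  | bot => intros; rfl
  | imp φ ψ ih1 ih2 =>
    intro v w h
    simp only [fvBound] at h
    simp only [Sat]
    rw [ih1 (fun i hi => h i (by omega)), ih2 (fun i hi => h i (by omega))]
  | all φ ih =>
    intro v w h
    simp only [fvBound] at h
    simp only [Sat]
    refine forall_congr' fun x => ih fun i hi => ?_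
    cases i with
    | zero => rfl
    | succ i => exact h i (by omega)

theorem sat_rename {φ : Fml} : ∀ {v : ℕ → M} {ρ : ℕ → ℕ},
    Sat E v (rename ρ φ) ↔ Sat E (fun i => v (ρ i)) φ := by
  induction φ with
  | mem i j => intros; rfl
  | eq i j => intros; rfl
  | bot => intros; rfl
  | imp φ ψ ih1 ih2 => intro v ρ; simp only [rename, Sat, ih1, ih2]
  | all φ ih =>
    intro v ρ
    simp only [rename, Sat, ih]
    refine forall_congr' fun x => Sat.congr fun i _ => ?_
    cases i <;> rfl

@[simp] theorem sat_neg {v : ℕ → M} {φ : Fml} : Sat E v (neg φ) ↔ ¬ Sat E v φ := Iff.rfl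

@[simp] theorem sat_conj {v : ℕ → M} {φ ψ : Fml} :
    Sat E v (conj φ ψ) ↔ Sat E v φ ∧ Sat E v ψ := by
  simp [conj, neg, Sat]

@[simp] theorem sat_disj {v : ℕ → M} {φ ψ : Fml} :
    Sat E v (disj φ ψ) ↔ Sat E v φ ∨ Sat E v ψ := by
  simp only [disj, neg, Sat]; tauto

@[simp] theorem sat_biimp {v : ℕ → M} {φ ψ : Fml} :
    Sat E v (biimp φ ψ) ↔ (Sat E v φ ↔ Sat E v ψ) := by
  simp only [biimp, sat_conj, Sat]; tauto

@[simp] theorem sat_ex {v : ℕ → M} {φ : Fml} :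
    Sat E v (ex φ) ↔ ∃ x, Sat E (scons x v) φ := by
  simp [ex, neg, Sat]

@[simp] theorem sat_allIn {v : ℕ → M} {φ : Fml} {y : ℕ} :
    Sat E v (allIn y φ) ↔ ∀ x, E x (v y) → Sat E (scons x v) φ := Iff.rfl

@[simp] theorem sat_exIn {v : ℕ → M} {φ : Fml} {y : ℕ} :
    Sat E v (exIn y φ) ↔ ∃ x, E x (v y) ∧ Sat E (scons x v) φ := by
  simp [exIn, Sat]

theorem sat_all_iterate {φ : Fml} (n : ℕ) :
    (∀ v, Sat E v (all^[n] φ)) ↔ ∀ v, Sat E v φ := by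
  induction n with
  | zero => rfl
  | succ n ih =>
    rw [Function.iterate_succ_apply', ← ih]
    refine ⟨fun h v => ?_, fun h v x => h _⟩
    have := h (fun k => v (k + 1)) (v 0)
    rwa [scons_eta] at this

theorem sat_univClosure {φ : Fml} :
    (∀ v, Sat E v (univClosure φ)) ↔ ∀ v, Sat E v φ := sat_all_iterate _

end Sat

/-! ### The completeness theorem -/

theorem fvBound_all_iterate (n : ℕ) (φ : Fml) : fvBound (all^[n] φ) = fvBound φ - n := by
  induction n with
  | zero => rfl
  | succ n ih => rw [Function.iterate_succ_apply', fvBound, ih]; omega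

theorem fvBound_univClosure (φ : Fml) : fvBound (univClosure φ) = 0 := by
  rw [univClosure, fvBound_all_iterate, Nat.sub_self]

/-- A Gödel numbering of the formulas. -/
def Fml.code : Fml → ℕ
  | mem i j => Nat.pair 0 (Nat.pair i j)
  | eq i j => Nat.pair 1 (Nat.pair i j)
  | bot => Nat.pair 2 0
  | imp φ ψ => Nat.pair 3 (Nat.pair (code φ) (code ψ))
  | all φ => Nat.pair 4 (code φ)

theorem Fml.code_injective : Function.Injective Fml.code := by
  intro φ
  induction φ with
  | imp φ ψ ih1 ih2 =>
    intro χ h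
    cases χ <;> simp only [code, Nat.pair_eq_pair] at h <;> first | omega | skip
    rw [ih1 h.2.1, ih2 h.2.2]
  | all φ ih =>
    intro χ h
    cases χ <;> simp only [code, Nat.pair_eq_pair] at h <;> first | omega | skip
    rw [ih h.2]
  | _ =>
    intro χ h
    cases χ <;> simp [code, Nat.pair_eq_pair] at h <;> simp [h]

/-- The finite sets of formulas that are consistent with `T`. -/
abbrev Condition (T : Set Fml) : Type :=
  {s : Set Fml // s.Finite ∧ ¬ Derives (T ∪ s) bot}

/-- A condition that decides `φ`, with a counterexample if `φ` is a refuted universal formula. -/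
def Decides {T : Set Fml} (φ : Fml) (s : Condition T) : Prop :=
  Derives (T ∪ s) φ ∨
    Derives (T ∪ s) (neg φ) ∧ ∀ χ, φ = all χ → ∃ y, Derives (T ∪ s) (neg (inst y χ))

theorem exists_fvBound_le {s : Set Fml} (hs : s.Finite) : ∃ n, ∀ φ ∈ s, fvBound φ ≤ n := by
  obtain ⟨n, hn⟩ := (hs.image fvBound).bddAbove
  exact ⟨n, fun φ hφ => hn (Set.mem_image_of_mem _ hφ)⟩

/-- Since `T` consists of sentences and `s` is finite, a fresh variable is available. If adding the
negated instance at that variable were inconsistent, generalization would prove the refuted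
universal formula. -/
theorem exists_decides {T : Set Fml} (hT : ∀ φ ∈ T, fvBound φ = 0) (φ : Fml) (s : Condition T) :
    ∃ s' : Condition T, Decides φ s' ∧ s ≤ s' := by
  obtain ⟨s, hfin, hcons⟩ := s
  have key : ∀ χ, ¬ Derives (insert χ (T ∪ s)) bot →
      ∃ s' : Condition T, s ⊆ s'.1 ∧ Derives (T ∪ s') χ := fun χ h =>
    ⟨⟨insert χ s, hfin.insert _, by rwa [Set.union_insert]⟩, Set.subset_insert _ _,
      .hyp (Or.inr (Set.mem_insert _ _))⟩
  by_cases h : Derives (insert φ (T ∪ s)) bot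
  · have hn : Derives (T ∪ s) (neg φ) := .impI h
    by_cases hφ : ∃ χ, φ = all χ
    · obtain ⟨χ, rfl⟩ := hφ
      obtain ⟨n, hn'⟩ := exists_fvBound_le hfin
      have h2 : ¬ Derives (insert (neg (inst (n + fvBound χ) χ)) (T ∪ s)) bot := by
        intro h2
        refine hcons (.impE hn (Derives.allI_fresh (y := n + fvBound χ) ?_ (by omega) (.raa h2)))
        rintro θ (hθ | hθ)
        · simp [hT θ hθ]
        · exact (hn' θ hθ).trans (by omega)
      obtain ⟨s', hs', h3⟩ := key _ h2
      refine ⟨s', Or.inr ⟨hn.mono (Set.union_subset_union_right _ hs'), ?_⟩, hs'⟩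
      rintro _ ⟨rfl⟩
      exact ⟨_, h3⟩
    · exact ⟨⟨s, hfin, hcons⟩, Or.inr ⟨hn, fun χ hχ => absurd ⟨χ, hχ⟩ hφ⟩, le_rfl⟩
  · obtain ⟨s', hs', h3⟩ := key _ h
    exact ⟨s', Or.inl h3, hs'⟩

/-- A deductively closed, consistent and complete set of formulas with witnesses. -/
structure IsHenkin (S : Set Fml) : Prop where
  closed : ∀ {φ ψ χ}, Derives {φ, ψ} χ → φ ∈ S → ψ ∈ S → χ ∈ S
  cons : bot ∉ S
  complete : ∀ φ, φ ∈ S ∨ neg φ ∈ S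
  witness : ∀ φ, all φ ∉ S → ∃ y, neg (inst y φ) ∈ S

/-- There are countably many formulas, so by the Rasiowa–Sikorski argument some ideal of conditions
contains `p` and decides every formula. The consequences of its members form the Henkin set. -/
theorem exists_isHenkin {T : Set Fml} (hT : ∀ φ ∈ T, fvBound φ = 0) (p : Condition T) :
    ∃ S, IsHenkin S ∧ T ⊆ S ∧ p.1 ⊆ S := by
  have : Countable Fml := code_injective.countable
  have : Encodable Fml := Encodable.ofCountable _
  let D : Fml → Order.Cofinal (Condition T) := fun φ =>
    ⟨{s | Decides φ s}, fun s => by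
      obtain ⟨s', h, h'⟩ := exists_decides hT φ s
      exact ⟨s', h, h'⟩⟩
  let I := Order.idealOfCofinals p D
  have hmono : ∀ {s s' : Condition T} {φ}, s ≤ s' → Derives (T ∪ s) φ → Derives (T ∪ s') φ :=
    fun h hd => hd.mono (Set.union_subset_union_right _ h)
  have hcons : ∀ {φ}, (∃ s ∈ I, Derives (T ∪ s) φ) → ¬ ∃ s ∈ I, Derives (T ∪ s) (neg φ) := by
    rintro φ ⟨s, hs, hd⟩ ⟨s', hs', hd'⟩
    obtain ⟨u, -, hsu, hsu'⟩ := I.directed s hs s' hs'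
    exact u.2.2 (.impE (hmono hsu' hd') (hmono hsu hd))
  have hgen : ∀ φ, ∃ s ∈ I, Decides φ s := fun φ => by
    obtain ⟨s, h, h'⟩ := Order.cofinal_meets_idealOfCofinals p D φ
    exact ⟨s, h', h⟩
  have hp : p ∈ I := Order.mem_idealOfCofinals p D
  refine ⟨{φ | ∃ s ∈ I, Derives (T ∪ s) φ}, ⟨?_, ?_, ?_, ?_⟩, ?_, ?_⟩
  · rintro φ ψ χ h ⟨s, hs, hd⟩ ⟨s', hs', hd'⟩
    obtain ⟨u, hu, hsu, hsu'⟩ := I.directed s hs s' hs'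
    refine ⟨u, hu, .impE (.impE (.impI (.impI (h.mono ?_))) (hmono hsu hd)) (hmono hsu' hd')⟩
    rintro θ (rfl | rfl)
    · exact Or.inr (Or.inl rfl)
    · exact Or.inl rfl
  · rintro ⟨s, -, hd⟩
    exact s.2.2 hd
  · intro φ
    obtain ⟨s, hs, h | h⟩ := hgen φ
    exacts [Or.inl ⟨s, hs, h⟩, Or.inr ⟨s, hs, h.1⟩]
  · intro φ hφ
    obtain ⟨s, hs, h | h⟩ := hgen (all φ)
    · exact absurd ⟨s, hs, h⟩ hφ
    · obtain ⟨y, hy⟩ := h.2 φ rfl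
      exact ⟨y, s, hs, hy⟩
  · exact fun φ hφ => ⟨p, hp, .hyp (Or.inl hφ)⟩
  · exact fun φ hφ => ⟨p, hp, .hyp (Or.inr hφ)⟩

namespace IsHenkin

variable {S : Set Fml} (h : IsHenkin S)

include h

theorem closed_one {φ χ : Fml} (hd : Derives {φ} χ) (hφ : φ ∈ S) : χ ∈ S :=
  h.closed (φ := φ) (ψ := φ) (hd.mono (by simp)) hφ hφ

theorem closed_zero {χ : Fml} (hd : Derives ∅ χ) : χ ∈ S := by
  obtain h' | h' := h.complete bot
  exacts [h.closed_one (hd.mono (Set.empty_subset _)) h', h.closed_one (hd.mono (Set.empty_subset _)) h']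

theorem neg_mem {φ : Fml} : neg φ ∈ S ↔ φ ∉ S :=
  ⟨fun h1 h2 => h.cons (h.closed (.impE (.hyp (Or.inl rfl)) (.hyp (Or.inr rfl))) h1 h2),
    (h.complete φ).resolve_left⟩

theorem imp_mem {φ ψ : Fml} : imp φ ψ ∈ S ↔ (φ ∈ S → ψ ∈ S) := by
  refine ⟨h.closed (.impE (.hyp (Or.inl rfl)) (.hyp (Or.inr rfl))), fun h1 => ?_⟩
  by_cases hφ : φ ∈ S
  · exact h.closed_one (.impI (.hyp (Or.inr rfl))) (h1 hφ)
  · exact h.closed_one (.impI (.exFalso (.impE (.hyp (Or.inr rfl)) (.hyp (Or.inl rfl)))))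
      (h.neg_mem.2 hφ)

theorem all_mem {φ : Fml} : all φ ∈ S ↔ ∀ t, inst t φ ∈ S := by
  refine ⟨fun h1 t => h.closed_one (.allE t (.hyp rfl)) h1, fun h1 => ?_⟩
  by_contra h2
  obtain ⟨y, hy⟩ := h.witness φ h2
  exact h.neg_mem.1 hy (h1 y)

/-- Provable equality in a Henkin set. -/
def setoid : Setoid ℕ where
  r i j := eq i j ∈ S
  iseqv :=
    { refl := fun i => h.closed_zero (.eqRefl i)
      symm := fun h1 => h.closed_one (.eqSymm (.hyp rfl)) h1
      trans := fun h1 h2 => h.closed (.eqTrans (.hyp (Or.inl rfl)) (.hyp (Or.inr rfl))) h1 h2 }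

theorem mem_congr {i j i' j' : ℕ} (hi : eq i i' ∈ S) (hj : eq j j' ∈ S) (hm : mem i j ∈ S) :
    mem i' j' ∈ S :=
  h.closed (φ := mem i j) (ψ := eq j j') (.memCongr (.eqRefl i) (.hyp (Or.inr rfl)) (.hyp (Or.inl rfl)))
    hm hj |> h.closed (.memCongr (.hyp (Or.inl rfl)) (.eqRefl j') (.hyp (Or.inr rfl))) hi

/-- The membership relation of the term model. -/
def rel : Quotient h.setoid → Quotient h.setoid → Prop :=
  Quotient.lift₂ (fun i j => mem i j ∈ S) fun _ _ _ _ hi hj => propext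
    ⟨h.mem_congr hi hj, h.mem_congr (h.setoid.symm hi) (h.setoid.symm hj)⟩

/-- Every element of the term model is the class of a variable, so the quantifier step is exactly
`all_mem`. -/
theorem sat_iff {φ : Fml} : ∀ ρ : ℕ → ℕ,
    Sat h.rel (fun i => Quotient.mk h.setoid (ρ i)) φ ↔ rename ρ φ ∈ S := by
  induction φ with
  | mem i j => intro ρ; exact Iff.rfl
  | eq i j => intro ρ; exact Quotient.eq (r := h.setoid)
  | bot => intro ρ; exact ⟨False.elim, h.cons⟩
  | imp φ ψ ih1 ih2 => intro ρ; simp only [Sat, rename, ih1, ih2, h.imp_mem]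
  | all φ ih =>
    intro ρ
    simp only [Sat, rename, h.all_mem]
    have key : ∀ t, Sat h.rel (scons (Quotient.mk h.setoid t) fun i => Quotient.mk h.setoid (ρ i)) φ ↔
        inst t (rename (liftRen ρ) φ) ∈ S := by
      intro t
      rw [← rename_scons, ← ih]
      refine Sat.congr fun i _ => ?_
      cases i <;> rfl
    exact ⟨fun h1 t => (key t).1 (h1 _), fun h1 x => Quotient.inductionOn x fun t => (key t).2 (h1 t)⟩

end IsHenkin

/-- The completeness theorem for sets of sentences. -/
theorem derives_of_valid {T : Set Fml} {χ : Fml} (hT : ∀ φ ∈ T, fvBound φ = 0)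
    (hχ : ∀ (M : Type) (E : M → M → Prop), Nonempty M → (∀ φ ∈ T, ∀ v, Sat E v φ) →
      ∀ v, Sat E v χ) : Derives T χ := by
  by_contra hcon
  have hc : ¬ Derives (T ∪ {neg χ}) bot := fun hd => hcon (.raa (by simpa using hd))
  obtain ⟨S, hS, hTS, hχS⟩ := exists_isHenkin hT ⟨{neg χ}, Set.finite_singleton _, hc⟩
  have hsat := fun φ => hS.sat_iff (φ := φ) id
  simp only [rename_id _ (ρ := id) fun _ _ => rfl] at hsat
  refine hS.neg_mem.1 (hχS rfl) ((hsat χ).1 (hχ _ hS.rel ⟨Quotient.mk _ 0⟩ (fun φ hφ v => ?_) _))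
  refine (Sat.congr fun i hi => ?_).1 ((hsat φ).2 (hTS hφ))
  rw [hT φ hφ] at hi
  omega

/-! ### `Δ₀` definable predicates in a model -/

/-- A model of the theory `C`. -/
class ModelC (M : Type) where
  E : M → M → Prop
  nonempty : Nonempty M
  valid : ∀ φ ∈ theoryC, ∀ v, Sat E v φ

instance instMembershipModel {M : Type} [ModelC M] : Membership M M := ⟨fun y x => ModelC.E x y⟩

instance {M : Type} [ModelC M] : Nonempty M := ModelC.nonempty

/-- Satisfaction in a model of `C`. -/
abbrev MSat {M : Type} [ModelC M] (v : ℕ → M) (φ : Fml) : Prop := Sat ModelC.E v φ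

theorem Fml.IsDelta0.rename {φ : Fml} (h : IsDelta0 φ) :
    ∀ ρ : ℕ → ℕ, IsDelta0 (Fml.rename ρ φ) := by
  induction h with
  | mem i j => exact fun ρ => .mem _ _
  | eq i j => exact fun ρ => .eq _ _
  | bot => exact fun ρ => .bot
  | imp _ _ ih1 ih2 => exact fun ρ => .imp (ih1 ρ) (ih2 ρ)
  | allIn y _ ih => exact fun ρ => .allIn (ρ y) (ih (liftRen ρ))
  | exIn y _ ih => exact fun ρ => .exIn (ρ y) (ih (liftRen ρ))

/-- A type of contexts: its elements carry values of variables in `M`, and the terms are the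
variables and the constants. -/
class Ctx (M Γ : Type) where
  tm : Set (Γ → M)
  const_mem : ∀ c : M, (fun _ => c) ∈ tm

instance {M : Type} : Ctx M Unit := ⟨Set.range fun c _ => c, fun c => ⟨c, rfl⟩⟩

instance {M Γ : Type} [Ctx M Γ] : Ctx M (Γ × M) :=
  ⟨{t | (∃ f ∈ Ctx.tm, t = fun p => f p.1) ∨ t = Prod.snd},
    fun c => Or.inl ⟨_, Ctx.const_mem c, rfl⟩⟩

/-- `t` is a term. -/
class Tm {M Γ : Type} [Ctx M Γ] (t : Γ → M) : Prop where
  mem : t ∈ Ctx.tm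

/-- `σ` is a change of contexts under which terms are substituted for variables. -/
class Proj (M : Type) {Γ Δ : Type} [Ctx M Γ] [Ctx M Δ] (σ : Δ → Γ) : Prop where
  comp : ∀ t ∈ Ctx.tm (M := M), (fun δ => t (σ δ)) ∈ Ctx.tm

section Ctx

variable {M Γ Δ : Type} [Ctx M Γ] [Ctx M Δ]

instance Proj.id : Proj M (fun γ : Γ => γ) := ⟨fun _ h => h⟩

instance Proj.fst {σ : Δ → Γ × M} [Proj M σ] : Proj M (fun δ => (σ δ).1) :=
  ⟨fun t h => Proj.comp (M := M) (σ := σ) (fun p => t p.1) (Or.inl ⟨t, h, rfl⟩)⟩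

instance Proj.fst' : Proj M (Prod.fst : Γ × M → Γ) := Proj.fst (σ := fun γ => γ)

instance Tm.const (c : M) : Tm (fun _ : Γ => c) := ⟨Ctx.const_mem c⟩

instance Tm.snd {σ : Δ → Γ × M} [Proj M σ] : Tm (fun δ => (σ δ).2) :=
  ⟨Proj.comp (σ := σ) _ (Or.inr rfl)⟩

instance Tm.snd' : Tm (Prod.snd : Γ × M → M) := Tm.snd (σ := fun γ => γ)

theorem Tm.comp (t : Γ → M) [ht : Tm t] (σ : Δ → Γ) [hσ : Proj M σ] : Tm (fun δ => t (σ δ)) :=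
  ⟨hσ.comp _ ht.mem⟩

theorem Proj.extend (σ : Δ → Γ) [hσ : Proj M σ] (t : Δ → M) [ht : Tm t] :
    Proj M (fun δ => (σ δ, t δ)) := by
  refine ⟨?_⟩
  rintro _ (⟨f, hf, rfl⟩ | rfl)
  · exact hσ.comp f hf
  · exact ht.mem

theorem Proj.comp_proj {Θ : Type} [Ctx M Θ] (σ : Δ → Γ) [hσ : Proj M σ] (τ : Θ → Δ)
    [hτ : Proj M τ] : Proj M (fun δ => σ (τ δ)) :=
  ⟨fun t h => hτ.comp _ (hσ.comp t h)⟩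

/-- The terms over `Γ × M` are the variable `Prod.snd` and the terms over `Γ`. -/
theorem exists_terms_fst (t : ℕ → Γ × M → M) (ht : ∀ i, t i ∈ Ctx.tm) (a : Γ → M) (ha : Tm a) :
    ∃ f : ℕ → Γ → M, (∀ i, f i ∈ Ctx.tm) ∧ ∀ i, t i ≠ Prod.snd → ∀ p, t i p = f i p.1 := by
  have : ∀ i, ∃ f : Γ → M, f ∈ Ctx.tm ∧ (t i ≠ Prod.snd → ∀ p, t i p = f p.1) := by
    intro i
    obtain ⟨f, hf, h⟩ | h := ht i
    · exact ⟨f, hf, fun _ p => by rw [h]⟩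
    · exact ⟨a, ha.mem, fun h' => absurd h h'⟩
  choose f hf using this
  exact ⟨f, fun i => (hf i).1, fun i => (hf i).2⟩

end Ctx

/-- `P` is definable by a `Δ₀` formula with parameters. -/
class D0 {M : Type} [ModelC M] {Γ : Type} [Ctx M Γ] (P : Γ → Prop) : Prop where
  out : ∃ φ, IsDelta0 φ ∧ ∃ t : ℕ → Γ → M, (∀ i, t i ∈ Ctx.tm) ∧
    ∀ γ, P γ ↔ MSat (fun i => t i γ) φ

section D0

variable {M : Type} [ModelC M] {Γ Δ : Type} [Ctx M Γ] [Ctx M Δ]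

theorem D0.congr {P Q : Γ → Prop} (h : D0 (M := M) P) (hPQ : ∀ γ, Q γ ↔ P γ) : D0 (M := M) Q := by
  obtain rfl : Q = P := funext fun γ => propext (hPQ γ)
  exact h

theorem D0.comp {P : Γ → Prop} (h : D0 (M := M) P) (σ : Δ → Γ) [hσ : Proj M σ] :
    D0 (M := M) (fun δ => P (σ δ)) := by
  obtain ⟨φ, hφ, t, ht, h⟩ := h.out
  exact ⟨φ, hφ, fun i δ => t i (σ δ), fun i => hσ.comp _ (ht i), fun δ => h (σ δ)⟩

instance D0.imp {P Q : Γ → Prop} [hP : D0 (M := M) P] [hQ : D0 (M := M) Q] :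
    D0 (M := M) (fun γ => P γ → Q γ) := by
  obtain ⟨φ, hφ, t, ht, h⟩ := hP.out
  obtain ⟨ψ, hψ, s, hs, h'⟩ := hQ.out
  -- Even and odd variables keep the two assignments apart.
  refine ⟨.imp (rename (fun i => 2 * i) φ) (rename (fun i => 2 * i + 1) ψ),
    .imp (hφ.rename _) (hψ.rename _), fun i => if i % 2 = 0 then t (i / 2) else s (i / 2), ?_, ?_⟩
  · intro i
    dsimp only
    split_ifs
    exacts [ht _, hs _]
  · intro γ
    simp only [MSat, Sat, sat_rename]
    rw [h, h']
    have e1 : ∀ i, 2 * i % 2 = 0 := fun i => by omega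
    have e2 : ∀ i, ¬ (2 * i + 1) % 2 = 0 := fun i => by omega
    have e3 : ∀ i, 2 * i / 2 = i := fun i => by omega
    have e4 : ∀ i, (2 * i + 1) / 2 = i := fun i => by omega
    simp only [e1, e2, e3, e4, if_true, if_false]

instance D0.false : D0 (M := M) (fun _ : Γ => False) :=
  ⟨.bot, .bot, fun _ _ => Classical.arbitrary M, fun _ => Ctx.const_mem _, fun _ => Iff.rfl⟩

instance D0.not {P : Γ → Prop} [hP : D0 (M := M) P] : D0 (M := M) (fun γ => ¬ P γ) :=
  (D0.imp (P := P) (Q := fun _ => False) : D0 (M := M) fun γ => P γ → False)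

instance D0.and {P Q : Γ → Prop} [hP : D0 (M := M) P] [hQ : D0 (M := M) Q] :
    D0 (M := M) (fun γ => P γ ∧ Q γ) :=
  (inferInstance : D0 (M := M) (fun γ => ¬ (P γ → ¬ Q γ))).congr fun γ => by tauto

instance D0.or {P Q : Γ → Prop} [hP : D0 (M := M) P] [hQ : D0 (M := M) Q] :
    D0 (M := M) (fun γ => P γ ∨ Q γ) :=
  (inferInstance : D0 (M := M) (fun γ => ¬ P γ → Q γ)).congr fun γ => by tauto

instance D0.iff {P Q : Γ → Prop} [hP : D0 (M := M) P] [hQ : D0 (M := M) Q] :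
    D0 (M := M) (fun γ => P γ ↔ Q γ) :=
  (inferInstance : D0 (M := M) (fun γ => (P γ → Q γ) ∧ (Q γ → P γ))).congr fun γ => by tauto

theorem D0.const (p : Prop) : D0 (M := M) (fun _ : Γ => p) := by
  by_cases h : p
  · exact (inferInstance : D0 (M := M) (fun _ : Γ => ¬ False)).congr fun γ => by simp [h]
  · exact (inferInstance : D0 (M := M) (fun _ : Γ => False)).congr fun γ => by simp [h]

theorem D0.eq_tm (s t : Γ → M) [hs : Tm s] [ht : Tm t] : D0 (M := M) (fun γ => s γ = t γ) :=
  ⟨.eq 0 1, .eq 0 1, scons s fun _ => t, fun i => by cases i; exacts [hs.mem, ht.mem],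
    fun _ => Iff.rfl⟩

open Classical in
instance D0.ex {t : Γ → M} {Q : Γ → M → Prop} [ht : Tm t]
    [hQ : D0 (M := M) fun p : Γ × M => Q p.1 p.2] :
    D0 (M := M) (fun γ => ∃ x, x ∈ t γ ∧ Q γ x) := by
  obtain ⟨φ, hφ, s, hs, h⟩ := hQ.out
  obtain ⟨f, hf, hsf⟩ := exists_terms_fst s hs t ht
  -- Under the quantifier, variable `0` is the bound element, `1` is its bound `t`, and `i + 2`
  -- carries the old term `f i`.
  refine ⟨exIn 0 (rename (fun i => if s i = Prod.snd then 0 else i + 2) φ),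
    .exIn _ (hφ.rename _), scons t f, fun i => by cases i; exacts [ht.mem, hf _], fun γ => ?_⟩
  rw [MSat, sat_exIn]
  refine exists_congr fun x => and_congr Iff.rfl ?_
  rw [sat_rename, h (γ, x)]
  refine Sat.congr fun i _ => ?_
  split_ifs with hi
  · rw [hi]; rfl
  · exact hsf i hi _

instance D0.all {t : Γ → M} {Q : Γ → M → Prop} [ht : Tm t]
    [hQ : D0 (M := M) fun p : Γ × M => Q p.1 p.2] :
    D0 (M := M) (fun γ => ∀ x, x ∈ t γ → Q γ x) :=
  (inferInstance : D0 (M := M) (fun γ => ¬ ∃ x, x ∈ t γ ∧ ¬ Q γ x)).congr fun γ => by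
    push Not; rfl

/-- `f` is a function with a `Δ₀` definable graph. -/
class SF (f : Γ → M) : Prop where
  graph : D0 (M := M) fun p : Γ × M => p.2 = f p.1

instance SF.tm {t : Γ → M} [Tm t] : SF t :=
  have := Tm.comp t (Prod.fst : Γ × M → Γ)
  ⟨D0.eq_tm _ _⟩

theorem SF.comp (f : Γ → M) [hf : SF f] (σ : Δ → Γ) [hσ : Proj M σ] : SF (fun δ => f (σ δ)) :=
  have := Proj.comp_proj (M := M) σ (Prod.fst : Δ × M → Δ)
  have := Proj.extend (fun p : Δ × M => σ p.1) Prod.snd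
  ⟨hf.graph.comp fun p : Δ × M => (σ p.1, p.2)⟩

instance D0.eq {t f : Γ → M} [Tm t] [hf : SF f] : D0 (M := M) (fun γ => t γ = f γ) :=
  have := Proj.extend (fun γ : Γ => γ) t
  hf.graph.comp fun γ => (γ, t γ)

instance D0.mem {f t : Γ → M} [hf : SF f] [Tm t] : D0 (M := M) (fun γ => f γ ∈ t γ) :=
  have := hf.graph
  (inferInstance : D0 (M := M) (fun γ => ∃ x, x ∈ t γ ∧ x = f γ)).congr fun γ => by simp

/-- Finite disjunctions. -/
theorem D0.exists_mem_list {α : Type} (l : List α) {P : α → Γ → Prop}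
    (h : ∀ x ∈ l, D0 (M := M) (P x)) : D0 (M := M) (fun γ => ∃ x, x ∈ l ∧ P x γ) := by
  induction l with
  | nil => exact (D0.const False).congr fun γ => by simp
  | cons a l ih =>
    have := h a (by simp)
    have := ih fun x hx => h x (by simp [hx])
    exact (inferInstance : D0 (M := M) (fun γ => P a γ ∨ ∃ x, x ∈ l ∧ P x γ)).congr fun γ => by simp

open Classical in
/-- `Δ₀` Separation. -/
theorem exists_sep (a : M) (P : M → Prop) [hP : D0 (M := M) fun p : Unit × M => P p.2] :
    ∃ b : M, ∀ x, x ∈ b ↔ x ∈ a ∧ P x := by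
  obtain ⟨φ, hφ, t, ht, h⟩ := hP.out
  obtain ⟨f, -, htf⟩ := exists_terms_fst t ht (fun _ => a) inferInstance
  have key := sat_univClosure.1 (ModelC.valid (M := M) _ (Or.inl (Or.inr ⟨_,
    hφ.rename (fun i => if t i = Prod.snd then 0 else i + 1), rfl⟩))) (fun i => f i ()) a
  obtain ⟨b, hb⟩ := sat_ex.1 key
  refine ⟨b, fun x => (sat_biimp.1 (hb x)).trans ?_⟩
  rw [sat_conj]
  refine and_congr Iff.rfl ?_
  rw [sat_rename, sat_rename, h ((), x)]
  refine Sat.congr fun i _ => ?_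
  by_cases hi : t i = Prod.snd
  · simp only [hi, if_true]; rfl
  · simp only [if_neg hi]; exact (htf i hi _).symm

end D0

/-! ### Basic set theory in a model -/

section Basic

variable {M : Type} [ModelC M]

theorem model_ext {x y : M} (h : ∀ z, z ∈ x ↔ z ∈ y) : x = y := by
  have := ModelC.valid (M := M) axExtensionality (by simp [theoryC, theoryB])
    (fun _ => x) x y
  simp [Sat] at this
  exact this h

theorem exists_upair (x y : M) : ∃ z : M, ∀ w, w ∈ z ↔ w = x ∨ w = y := by
  have := ModelC.valid (M := M) axPair (by simp [theoryC, theoryB])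
    (fun _ => x) x y
  simp [isUPair, Sat] at this
  exact this

theorem exists_sUnion (x : M) : ∃ z : M, ∀ w, w ∈ z ↔ ∃ y ∈ x, w ∈ y := by
  have := ModelC.valid (M := M) axUnion (by simp [theoryC, theoryB])
    (fun _ => x) x
  simp [Sat] at this
  exact this

theorem exists_minimal_mem {x : M} (h : ∃ y, y ∈ x) : ∃ y ∈ x, ∀ z ∈ x, z ∉ y := by
  have := ModelC.valid (M := M) axRegularity (by simp [theoryC, theoryB])
    (fun _ => x) x
  simp [Sat] at this
  obtain ⟨y, hy⟩ := h
  exact this y hy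

theorem exists_transitive_superset (x : M) :
    ∃ y : M, (∀ z ∈ y, ∀ w ∈ z, w ∈ y) ∧ ∀ z ∈ x, z ∈ y := by
  have := ModelC.valid (M := M) axTransitiveClosure (by simp [theoryC, theoryB])
    (fun _ => x) x
  simp [Sat, isTransitive, subset] at this
  obtain ⟨y, h, -⟩ := this
  exact ⟨y, h.1, h.2⟩

theorem exists_empty : ∃ x : M, ∀ y, y ∉ x := by
  have := D0.const (M := M) (Γ := Unit × M) False
  obtain ⟨b, hb⟩ := exists_sep (Classical.arbitrary M) (fun _ => False)
  exact ⟨b, by simpa using hb⟩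

variable (M) in
/-- The empty set. -/
noncomputable def emp : M := Classical.choose (exists_empty (M := M))

@[simp] theorem notMem_emp (y : M) : y ∉ emp M := Classical.choose_spec exists_empty y

/-- The unordered pair. -/
noncomputable def upair (x y : M) : M := Classical.choose (exists_upair x y)

@[simp] theorem mem_upair {x y z : M} : z ∈ upair x y ↔ z = x ∨ z = y :=
  Classical.choose_spec (exists_upair x y) z

/-- The Kuratowski pair. -/
noncomputable def pair (x y : M) : M := upair (upair x x) (upair x y)

theorem upair_self_inj {x y : M} : upair x x = upair y y ↔ x = y := by
  refine ⟨fun h => ?_, fun h => by rw [h]⟩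
  have : x ∈ upair y y := h ▸ mem_upair.2 (Or.inl rfl)
  simpa using this

theorem upair_left_inj {x y z : M} (h : upair x y = upair x z) : y = z := by
  have h1 : y ∈ upair x z := h ▸ mem_upair.2 (Or.inr rfl)
  have h2 : z ∈ upair x y := h ▸ mem_upair.2 (Or.inr rfl)
  rw [mem_upair] at h1 h2
  grind

@[simp] theorem pair_inj {x y x' y' : M} : pair x y = pair x' y' ↔ x = x' ∧ y = y' := by
  refine ⟨fun h => ?_, fun h => by rw [h.1, h.2]⟩
  have hx : x = x' := by
    have h1 : upair x x ∈ pair x' y' := h ▸ mem_upair.2 (Or.inl rfl)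
    have h2 : x' ∈ upair x x := by
      rcases mem_upair.1 h1 with h1 | h1 <;> rw [h1] <;> simp
    simpa [eq_comm] using h2
  subst hx
  exact ⟨rfl, upair_left_inj (upair_left_inj h)⟩

/-- The graph is `Δ₀` because the two components can be sought among the elements of the pair
itself. -/
instance SF.upair {Γ : Type} [Ctx M Γ] {f g : Γ → M} [hf : SF f] [hg : SF g] :
    SF (fun γ => upair (f γ) (g γ)) := by
  have := SF.comp f (fun p : ((Γ × M) × M) × M => p.1.1.1)
  have := SF.comp g (fun p : ((Γ × M) × M) × M => p.1.1.1)
  refine ⟨(inferInstance : D0 (M := M) (fun p : Γ × M => ∃ x, x ∈ p.2 ∧ ∃ y, y ∈ p.2 ∧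
    ((x = f p.1 ∧ y = g p.1) ∧ ∀ w, w ∈ p.2 → w = x ∨ w = y))).congr ?_⟩
  rintro ⟨γ, z⟩
  dsimp only
  constructor
  · rintro rfl
    simp
  · rintro ⟨x, hx, y, hy, ⟨rfl, rfl⟩, h⟩
    refine model_ext fun w => ⟨fun hw => mem_upair.2 (h w hw), fun hw => ?_⟩
    rcases mem_upair.1 hw with rfl | rfl <;> assumption

instance SF.pair {Γ : Type} [Ctx M Γ] {f g : Γ → M} [hf : SF f] [hg : SF g] :
    SF (fun γ => pair (f γ) (g γ)) :=
  (inferInstance : SF (fun γ => SetTh.upair (SetTh.upair (f γ) (f γ)) (SetTh.upair (f γ) (g γ))))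

theorem exists_union (x y : M) : ∃ z : M, ∀ w, w ∈ z ↔ w ∈ x ∨ w ∈ y := by
  obtain ⟨z, hz⟩ := exists_sUnion (upair x y)
  exact ⟨z, fun w => by rw [hz]; simp⟩

/-! ### Semantics of the set-theoretic notions -/

theorem mE {x y : M} : ModelC.E x y ↔ x ∈ y := Iff.rfl

@[simp] theorem sat_mem {v : ℕ → M} {i j : ℕ} : Sat ModelC.E v (mem i j) ↔ v i ∈ v j := Iff.rfl

@[simp] theorem sat_eq {v : ℕ → M} {i j : ℕ} : Sat ModelC.E v (eq i j) ↔ v i = v j := Iff.rfl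

@[simp] theorem sat_isUPair {v : ℕ → M} {z x y : ℕ} :
    Sat ModelC.E v (isUPair z x y) ↔ v z = upair (v x) (v y) := by
  simp only [isUPair, Sat, sat_biimp, sat_disj, scons_zero, scons_succ, mE]
  exact ⟨fun h => model_ext fun w => by rw [h, mem_upair], fun h w => by rw [h, mem_upair]⟩

@[simp] theorem sat_isPair {v : ℕ → M} {z x y : ℕ} :
    Sat ModelC.E v (isPair z x y) ↔ v z = pair (v x) (v y) := by
  simp only [isPair, Sat, sat_biimp, sat_disj, scons_zero, scons_succ, mE, sat_isUPair]
  exact ⟨fun h => model_ext fun w => by rw [h, pair, mem_upair],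
    fun h w => by rw [h, pair, mem_upair]⟩

@[simp] theorem sat_pairMem {v : ℕ → M} {x y r : ℕ} :
    Sat ModelC.E v (pairMem x y r) ↔ pair (v x) (v y) ∈ v r := by
  simp [pairMem]

@[simp] theorem sat_isRel {v : ℕ → M} {r x y : ℕ} :
    Sat ModelC.E v (isRel r x y) ↔ ∀ z ∈ v r, ∃ a ∈ v x, ∃ b ∈ v y, z = pair a b := by
  simp [isRel, mE]

@[simp] theorem sat_isWF {v : ℕ → M} {x r : ℕ} :
    Sat ModelC.E v (isWF x r) ↔ (∀ z ∈ v r, ∃ a ∈ v x, ∃ b ∈ v x, z = pair a b) ∧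
      ∀ y : M, (∀ z ∈ y, z ∈ v x) → (∃ z, z ∈ y) → ∃ m ∈ y, ∀ z ∈ y, pair z m ∉ v r := by
  simp [isWF, mE, Sat, subset]

@[simp] theorem sat_isFun {v : ℕ → M} {f x y : ℕ} :
    Sat ModelC.E v (isFun f x y) ↔ (∀ z ∈ v f, ∃ a ∈ v x, ∃ b ∈ v y, z = pair a b) ∧
      ∀ a ∈ v x, ∃ b, ∀ c, pair a c ∈ v f ↔ c = b := by
  simp [isFun, mE, Sat]

theorem sat_isFinite_upair {v : ℕ → M} {i : ℕ} {x y : M} (h : v i = upair x y) :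
    Sat ModelC.E v (isFinite i) := by
  simp only [isFinite, sat_ex, sat_conj, isBij, sat_isFun, isNat, isOrd, isTransitive, subset,
    isZeroOrSucc, sat_allIn, Sat, sat_biimp, sat_disj, sat_neg, scons_zero, scons_succ,
    sat_pairMem, mE, h]
  have h0 : emp M ≠ upair (emp M) (emp M) := fun h0 => by
    have h1 : emp M ∈ upair (emp M) (emp M) := mem_upair.2 (Or.inl rfl)
    rw [← h0] at h1
    exact notMem_emp _ h1
  by_cases hxy : x = y
  · subst hxy
    -- The ordinal `1 = {∅}`.
    refine ⟨upair (emp M) (emp M), ⟨⟨?_, ?_⟩, Or.inr ⟨emp M, ?_⟩, ?_⟩,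
      upair (pair x (emp M)) (pair x (emp M)), ⟨?_, ?_⟩, ?_⟩
    all_goals simp
  · refine ⟨upair (emp M) (upair (emp M) (emp M)),
      ⟨⟨?_, ?_⟩, Or.inr ⟨upair (emp M) (emp M), ?_⟩, ?_⟩,
      upair (pair x (emp M)) (pair y (upair (emp M) (emp M))), ⟨?_, ?_⟩, ?_⟩
    · simp
    · simp
    · simp
    · intro z hz
      rcases mem_upair.1 hz with rfl | rfl
      · simp
      · exact Or.inr ⟨emp M, by simp⟩
    · simp
    · intro z hz
      rcases mem_upair.1 hz with rfl | rfl
      · exact ⟨emp M, by simp [hxy]⟩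
      · exact ⟨upair (emp M) (emp M), by simp [Ne.symm hxy]⟩
    · intro z hz
      rcases mem_upair.1 hz with rfl | rfl
      · exact ⟨x, by simp [h0]⟩
      · exact ⟨y, by simp [Ne.symm h0]⟩

theorem exists_finitePowerset (x : M) :
    ∃ z : M, ∀ u ∈ x, ∀ w ∈ x, upair u w ∈ z := by
  have := ModelC.valid (M := M) axFinitePowerset (by simp [theoryC, theoryB]) (fun _ => x) x
  simp only [sat_ex, Sat, sat_biimp, sat_conj, subset, sat_allIn, scons_zero, scons_succ, mE] at this
  obtain ⟨z, hz⟩ := this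
  refine ⟨z, fun u hu w hw => (hz _).2 ⟨fun t ht => ?_, sat_isFinite_upair (x := u) (y := w) rfl⟩⟩
  rcases mem_upair.1 ht with rfl | rfl <;> assumption

/-- A Kuratowski pair has at most two elements, each with at most two elements from `a ∪ b`. Hence
Finite Powerset, applied twice, bounds the product. -/
theorem exists_prod (a b : M) : ∃ z : M, ∀ w, w ∈ z ↔ ∃ x ∈ a, ∃ y ∈ b, w = pair x y := by
  obtain ⟨c, hc⟩ := exists_union a b
  obtain ⟨d, hd⟩ := exists_finitePowerset c
  obtain ⟨e, he⟩ := exists_finitePowerset d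
  obtain ⟨z, hz⟩ := exists_sep e (fun w => ∃ x ∈ a, ∃ y ∈ b, w = pair x y)
  refine ⟨z, fun w => (hz w).trans (and_iff_right_of_imp ?_)⟩
  rintro ⟨x, hx, y, hy, rfl⟩
  have hx := (hc x).2 (Or.inl hx)
  have hy := (hc y).2 (Or.inr hy)
  exact he _ (hd _ hx _ hx) _ (hd _ hx _ hy)

/-- The Cartesian product. -/
noncomputable def prod (a b : M) : M := Classical.choose (exists_prod a b)

theorem mem_prod {a b w : M} : w ∈ prod a b ↔ ∃ x ∈ a, ∃ y ∈ b, w = pair x y :=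
  Classical.choose_spec (exists_prod a b) w

@[simp] theorem pair_mem_prod {a b x y : M} : pair x y ∈ prod a b ↔ x ∈ a ∧ y ∈ b := by
  rw [mem_prod]
  constructor
  · rintro ⟨x', hx, y', hy, h⟩
    rw [pair_inj] at h
    rw [h.1, h.2]
    exact ⟨hx, hy⟩
  · exact fun h => ⟨x, h.1, y, h.2, rfl⟩

/-- The Zermelo numerals. -/
noncomputable def num : ℕ → M
  | 0 => emp M
  | n + 1 => upair (num n) (num n)

theorem num_injective : Function.Injective (num (M := M)) := by
  intro m
  have h : ∀ n, num (n + 1) ≠ emp M := fun n h =>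
    notMem_emp (num n) (by rw [← h]; simp [num])
  induction m with
  | zero =>
    rintro (_ | n) hn
    · rfl
    · exact absurd hn.symm (h n)
  | succ m ih =>
    rintro (_ | n) hn
    · exact absurd hn (h m)
    · rw [ih (upair_self_inj.1 hn)]

@[simp] theorem num_inj {m n : ℕ} : (num m : M) = num n ↔ m = n := num_injective.eq_iff

/-! ### `Δ₀` definable relations and their collapses -/

/-- `R` is a `Δ₀` definable binary relation. -/
class D0Rel (R : M → M → Prop) : Prop where
  out : D0 (M := M) fun p : (Unit × M) × M => R p.1.2 p.2

theorem D0Rel.d0 {R : M → M → Prop} [hR : D0Rel R] {Γ : Type} [Ctx M Γ] (s t : Γ → M) [hs : Tm s]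
    [ht : Tm t] : D0 (M := M) fun γ => R (s γ) (t γ) := by
  have h0 : Proj M (fun _ : Γ => ()) := ⟨by rintro _ ⟨c, rfl⟩; exact Ctx.const_mem c⟩
  have := Proj.extend (fun _ : Γ => ()) s
  have := Proj.extend (fun γ : Γ => ((), s γ)) t
  exact hR.out.comp fun γ => (((), s γ), t γ)

/-- The relation `R` is well founded on `x`. -/
def WFOn (x : M) (R : M → M → Prop) : Prop :=
  ∀ y : M, (∀ z ∈ y, z ∈ x) → (∃ z, z ∈ y) → ∃ m ∈ y, ∀ z ∈ y, ¬ R z m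

theorem exists_rel (x : M) (R : M → M → Prop) [D0Rel R] :
    ∃ r : M, (∀ w ∈ r, w ∈ prod x x) ∧ ∀ u ∈ x, ∀ v ∈ x, pair u v ∈ r ↔ R u v := by
  have hd : ∀ {Γ : Type} [Ctx M Γ] (s t : Γ → M) [Tm s] [Tm t],
    D0 (M := M) fun γ => R (s γ) (t γ) := D0Rel.d0
  obtain ⟨r, hr⟩ := exists_sep (prod x x) fun w => ∃ u ∈ x, ∃ v ∈ x, w = pair u v ∧ R u v
  refine ⟨r, fun w hw => ((hr w).1 hw).1, fun u hu v hv => ?_⟩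
  rw [hr]
  constructor
  · rintro ⟨-, u', -, v', -, h, h'⟩
    rw [pair_inj] at h
    rwa [h.1, h.2]
  · exact fun h => ⟨by simp [hu, hv], u, hu, v, hv, rfl, h⟩

/-- Axiom Beta for `Δ₀` definable relations. -/
theorem exists_collapse (x : M) (R : M → M → Prop) [D0Rel R] (hR : WFOn x R) :
    ∃ (Y F : M) (π : M → M), (∀ u ∈ x, π u ∈ Y) ∧ (∀ u ∈ x, ∀ z, pair u z ∈ F ↔ z = π u) ∧
      ∀ u ∈ x, ∀ w, w ∈ π u ↔ ∃ v ∈ x, R v u ∧ w = π v := by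
  obtain ⟨r, hr, hr'⟩ := exists_rel x R
  have := ModelC.valid (M := M) axBeta (by simp [theoryC]) (fun _ => x) x r
  simp only [Sat, sat_isWF, sat_ex, sat_conj, sat_isFun, sat_allIn, sat_biimp, sat_exIn,
    scons_zero, scons_succ, sat_pairMem, mE] at this
  obtain ⟨Y, F, -, ⟨hF1, hF2⟩, hF3⟩ := this (by
    refine ⟨fun z hz => ?_, fun y hy hne => ?_⟩
    · exact mem_prod.1 (hr z hz)
    · obtain ⟨m, hm, h⟩ := hR y hy hne
      exact ⟨m, hm, fun z hz => by rw [hr' z (hy z hz) m (hy m hm)]; exact h z hz⟩)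
  -- `π` is a function outside the model; its graph `F` and range bound `Y` are kept as parameters
  -- for Separation.
  choose! π hπ using hF2
  have hπ' : ∀ u ∈ x, pair u (π u) ∈ F := fun u hu => (hπ u hu _).2 rfl
  refine ⟨Y, F, π, fun u hu => ?_, hπ, fun u hu w => ?_⟩
  · obtain ⟨a, -, b, hb, h⟩ := hF1 _ (hπ' u hu)
    rw [pair_inj] at h
    rwa [h.2]
  · rw [hF3 u hu _ (hπ' u hu)]
    refine exists_congr fun v => and_congr_right fun hv => ?_
    rw [hr' v hv u hu, hπ v hv]

end Basic

/-! ### Values of well founded games by collapsing -/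

section Game

variable {M : Type} [ModelC M]

theorem exists_set_of_list (l : List M) : ∃ z : M, ∀ x, x ∈ z ↔ x ∈ l := by
  induction l with
  | nil => exact ⟨emp M, by simp⟩
  | cons a l ih =>
    obtain ⟨z, hz⟩ := ih
    obtain ⟨w, hw⟩ := exists_union (upair a a) z
    exact ⟨w, fun x => by rw [hw, hz]; simp⟩

/-- A system of sets `px n`, `py n`, `pQ n`, `pP n m`, tagged by the sets `{∅, n}`, in which the
equality of `px n` and `py n` reflects a conjunction (if `n ∈ ℓ`) or a disjunction of the
equalities of `px m` and `py m`, where `⟨m, n⟩ ∈ r`. -/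
structure IsGadget (N r ℓ : M) (px py pQ : M → M) (pP : M → M → M) : Prop where
  x : ∀ n ∈ N, ∀ w, w ∈ px n ↔ w = upair (emp M) n ∨
    (n ∈ ℓ ∧ ∃ m ∈ N, pair m n ∈ r ∧ w = px m) ∨
    (n ∉ ℓ ∧ ((∃ m ∈ N, pair m n ∈ r ∧ w = pP n m) ∨ w = pQ n))
  y : ∀ n ∈ N, ∀ w, w ∈ py n ↔ w = upair (emp M) n ∨
    (n ∈ ℓ ∧ ∃ m ∈ N, pair m n ∈ r ∧ w = py m) ∨
    (n ∉ ℓ ∧ ∃ m ∈ N, pair m n ∈ r ∧ w = pP n m)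
  Q : ∀ n ∈ N, ∀ w, w ∈ pQ n ↔ w = upair (emp M) n ∨ ∃ m ∈ N, pair m n ∈ r ∧ w = px m
  P : ∀ n ∈ N, ∀ m ∈ N, ∀ w, w ∈ pP n m ↔ w = upair (emp M) n ∨
    (∃ j ∈ N, pair j n ∈ r ∧ ¬ j = m ∧ w = px j) ∨ (pair m n ∈ r ∧ w = py m)

/-- Tags contain `∅` and gadget sets do not, so a gadget set is never mistaken for a tag. -/
theorem upair_emp_ne_of_notMem {n g : M} (h : emp M ∉ g) : g ≠ upair (emp M) n := by
  rintro rfl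
  exact h (mem_upair.2 (Or.inl rfl))

-- The tag in a set `px n` or `py n` determines `n`. An equality of collections of such sets
-- therefore matches them index by index, which yields the conjunction. In the disjunctive case `py
-- n` lacks only `pQ n`, so equality says that `pQ n` is some `pP n m`; as `px m` then lies in `pP n
-- m`, where it is left out as an `x`-set, it must be `py m`.
open Classical in
theorem IsGadget.eq_iff {N r ℓ : M} {px py pQ : M → M} {pP : M → M → M}
    (h : IsGadget N r ℓ px py pQ pP) {n : M} (hn : n ∈ N) :
    px n = py n ↔ if n ∈ ℓ then ∀ m ∈ N, pair m n ∈ r → px m = py m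
      else ∃ m ∈ N, pair m n ∈ r ∧ px m = py m := by
  have ne : ∀ {t g : M}, t ∈ g → g ≠ emp M := by
    rintro t _ ht rfl
    exact notMem_emp _ ht
  have tx : ∀ n ∈ N, upair (emp M) n ∈ px n := fun n hn => (h.x n hn _).2 (Or.inl rfl)
  have ty : ∀ n ∈ N, upair (emp M) n ∈ py n := fun n hn => (h.y n hn _).2 (Or.inl rfl)
  have tQ : ∀ n ∈ N, upair (emp M) n ∈ pQ n := fun n hn => (h.Q n hn _).2 (Or.inl rfl)
  have tP : ∀ n ∈ N, ∀ m ∈ N, upair (emp M) n ∈ pP n m :=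
    fun n hn m hm => (h.P n hn m hm _).2 (Or.inl rfl)
  have tne : ∀ n : M, upair (emp M) n ≠ emp M := fun n => ne (mem_upair.2 (Or.inl rfl))
  have ex : ∀ n ∈ N, emp M ∉ px n := by
    intro n hn he
    obtain he | ⟨-, m, hm, -, he⟩ | ⟨-, ⟨m, hm, -, he⟩ | he⟩ := (h.x n hn _).1 he
    exacts [tne _ he.symm, ne (tx m hm) he.symm, ne (tP n hn m hm) he.symm, ne (tQ n hn) he.symm]
  have ey : ∀ n ∈ N, emp M ∉ py n := by
    intro n hn he
    obtain he | ⟨-, m, hm, -, he⟩ | ⟨-, m, hm, -, he⟩ := (h.y n hn _).1 he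
    exacts [tne _ he.symm, ne (ty m hm) he.symm, ne (tP n hn m hm) he.symm]
  have eQ : ∀ n ∈ N, emp M ∉ pQ n := by
    intro n hn he
    obtain he | ⟨m, hm, -, he⟩ := (h.Q n hn _).1 he
    exacts [tne _ he.symm, ne (tx m hm) he.symm]
  have eP : ∀ n ∈ N, ∀ m ∈ N, emp M ∉ pP n m := by
    intro n hn m hm he
    obtain he | ⟨j, hj, -, -, he⟩ | ⟨-, he⟩ := (h.P n hn m hm _).1 he
    exacts [tne _ he.symm, ne (tx j hj) he.symm, ne (ty m hm) he.symm]
  -- The only tag in `px n` is its own.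
  have ix : ∀ n ∈ N, ∀ m, upair (emp M) m ∈ px n → m = n := by
    intro n hn m hm
    obtain he | ⟨-, j, hj, -, he⟩ | ⟨-, ⟨j, hj, -, he⟩ | he⟩ := (h.x n hn _).1 hm
    · exact upair_left_inj he
    · exact absurd he.symm (upair_emp_ne_of_notMem (ex j hj))
    · exact absurd he.symm (upair_emp_ne_of_notMem (eP n hn j hj))
    · exact absurd he.symm (upair_emp_ne_of_notMem (eQ n hn))
  have iy : ∀ n ∈ N, ∀ m, upair (emp M) m ∈ py n → m = n := by
    intro n hn m hm
    obtain he | ⟨-, j, hj, -, he⟩ | ⟨-, j, hj, -, he⟩ := (h.y n hn _).1 hm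
    · exact upair_left_inj he
    · exact absurd he.symm (upair_emp_ne_of_notMem (ey j hj))
    · exact absurd he.symm (upair_emp_ne_of_notMem (eP n hn j hj))
  have xx : ∀ m ∈ N, ∀ j ∈ N, px m = px j → m = j := fun m hm j hj he =>
    ix j hj m (he ▸ tx m hm)
  have xy : ∀ m ∈ N, ∀ j ∈ N, px m = py j → m = j := fun m hm j hj he =>
    iy j hj m (he ▸ tx m hm)
  split_ifs with hℓ
  · constructor
    · intro he m hm hmr
      have h1 : px m ∈ py n := he ▸ (h.x n hn _).2 (Or.inr (Or.inl ⟨hℓ, m, hm, hmr, rfl⟩))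
      obtain h2 | ⟨-, j, hj, -, h2⟩ | ⟨h2, -⟩ := (h.y n hn _).1 h1
      · exact absurd h2 (upair_emp_ne_of_notMem (ex m hm))
      · obtain rfl := xy m hm j hj h2
        exact h2
      · exact absurd hℓ h2
    · intro he
      refine model_ext fun w => ?_
      rw [h.x n hn, h.y n hn]
      simp only [hℓ, true_and, not_true_eq_false, false_and, or_false]
      refine or_congr Iff.rfl (exists_congr fun m => and_congr_right fun hm =>
        and_congr_right fun hmr => ?_)
      rw [he m hm hmr]
  · constructor
    · intro he
      have h1 : pQ n ∈ py n := he ▸ (h.x n hn _).2 (Or.inr (Or.inr ⟨hℓ, Or.inr rfl⟩))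
      obtain h2 | ⟨h2, -⟩ | ⟨-, m, hm, hmr, h2⟩ := (h.y n hn _).1 h1
      · exact absurd h2 (upair_emp_ne_of_notMem (eQ n hn))
      · exact absurd h2 hℓ
      · refine ⟨m, hm, hmr, ?_⟩
        have h3 : px m ∈ pP n m := h2 ▸ (h.Q n hn _).2 (Or.inr ⟨m, hm, hmr, rfl⟩)
        obtain h4 | ⟨j, hj, -, hjm, h4⟩ | ⟨-, h4⟩ := (h.P n hn m hm _).1 h3
        · exact absurd h4 (upair_emp_ne_of_notMem (ex m hm))
        · exact absurd (xx m hm j hj h4).symm hjm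
        · exact h4
    · rintro ⟨m, hm, hmr, he⟩
      have h1 : pQ n = pP n m := by
        refine model_ext fun w => ?_
        rw [h.Q n hn, h.P n hn m hm]
        refine or_congr Iff.rfl ⟨?_, ?_⟩
        · rintro ⟨j, hj, hjr, rfl⟩
          by_cases hjm : j = m
          · subst hjm; exact Or.inr ⟨hjr, he⟩
          · exact Or.inl ⟨j, hj, hjr, hjm, rfl⟩
        · rintro (⟨j, hj, hjr, -, rfl⟩ | ⟨-, rfl⟩)
          exacts [⟨j, hj, hjr, rfl⟩, ⟨m, hm, hmr, he.symm⟩]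
      refine model_ext fun w => ?_
      rw [h.x n hn, h.y n hn]
      simp only [hℓ, false_and, false_or, not_false_eq_true, true_and]
      refine or_congr Iff.rfl (or_iff_left_of_imp ?_)
      rintro rfl
      exact ⟨m, hm, hmr, h1⟩

/-- The relation whose collapse consists of a transitive set `T` and of a gadget. -/
def gadgetRel (T N r ℓ v u : M) : Prop :=
  -- Nodes with first component `0` stand for the elements of `T`; those with `1`, `2`, `3`, `4`
  -- stand for `px`, `py`, `pQ`, `pP`.
  (∃ t ∈ T, ∃ s ∈ T, v = pair (num 0) t ∧ u = pair (num 0) s ∧ t ∈ s) ∨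
  (∃ n ∈ N, (u = pair (num 1) n ∨ u = pair (num 2) n ∨ u = pair (num 3) n ∨
    ∃ m ∈ N, u = pair (num 4) (pair n m)) ∧ v = pair (num 0) (upair (emp M) n)) ∨
  (∃ n ∈ N, (u = pair (num 1) n ∨ u = pair (num 2) n) ∧ n ∉ ℓ ∧
    ∃ m ∈ N, pair m n ∈ r ∧ v = pair (num 4) (pair n m)) ∨
  (∃ n ∈ N, u = pair (num 1) n ∧ n ∉ ℓ ∧ v = pair (num 3) n) ∨
  (∃ n ∈ N, (u = pair (num 3) n ∨ u = pair (num 1) n ∧ n ∈ ℓ) ∧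
    ∃ m ∈ N, pair m n ∈ r ∧ v = pair (num 1) m) ∨
  (∃ n ∈ N, u = pair (num 2) n ∧ n ∈ ℓ ∧ ∃ m ∈ N, pair m n ∈ r ∧ v = pair (num 2) m) ∨
  (∃ n ∈ N, ∃ m ∈ N, u = pair (num 4) (pair n m) ∧
    ((∃ j ∈ N, pair j n ∈ r ∧ ¬ j = m ∧ v = pair (num 1) j) ∨ pair m n ∈ r ∧ v = pair (num 2) m))

instance (T N r ℓ : M) : D0Rel (gadgetRel T N r ℓ) := by
  unfold gadgetRel
  set_option synthInstance.maxHeartbeats 400000 in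
  set_option synthInstance.maxSize 4000 in
  exact ⟨inferInstance⟩

theorem exists_gadgetNodes (T N : M) : ∃ z : M, ∀ w, w ∈ z ↔ (∃ t ∈ T, w = pair (num 0) t) ∨
    (∃ n ∈ N, w = pair (num 1) n ∨ w = pair (num 2) n ∨ w = pair (num 3) n ∨
      ∃ m ∈ N, w = pair (num 4) (pair n m)) := by
  obtain ⟨k, hk⟩ := exists_set_of_list (M := M) [num 0, num 1, num 2, num 3, num 4]
  obtain ⟨a, ha⟩ := exists_union T N
  obtain ⟨b, hb⟩ := exists_union a (prod N N)
  obtain ⟨z, hz⟩ := exists_sep (prod k b) fun w => (∃ t ∈ T, w = pair (num 0 : M) t) ∨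
    (∃ n ∈ N, w = pair (num 1 : M) n ∨ w = pair (num 2 : M) n ∨ w = pair (num 3 : M) n ∨
      ∃ m ∈ N, w = pair (num 4 : M) (pair n m))
  refine ⟨z, fun w => (hz w).trans (and_iff_right_of_imp ?_)⟩
  rintro (⟨t, ht, rfl⟩ | ⟨n, hn, rfl | rfl | rfl | ⟨m, hm, rfl⟩⟩) <;> simp [*]

/-- If a node of `T` occurs in the subset, Regularity gives a minimal one. Otherwise take an
`r`-minimal index `n` and, among its nodes, prefer `pQ` and `pP` to `px` and `py`, which are built
from them. -/
theorem gadgetRel_wf {T N r ℓ z : M} (hN : ∀ n ∈ N, upair (emp M) n ∈ T)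
    (hr : WFOn N fun m n => pair m n ∈ r)
    (hz : ∀ w, w ∈ z ↔ (∃ t ∈ T, w = pair (num 0) t) ∨
    (∃ n ∈ N, w = pair (num 1) n ∨ w = pair (num 2) n ∨ w = pair (num 3) n ∨
      ∃ m ∈ N, w = pair (num 4) (pair n m))) : WFOn z (gadgetRel T N r ℓ) := by
  intro y hy hne
  obtain ⟨B, hB⟩ := exists_sep T fun t => pair (num 0 : M) t ∈ y
  by_cases hBne : ∃ t, t ∈ B
  · obtain ⟨t, ht, hmin⟩ := exists_minimal_mem hBne
    refine ⟨_, ((hB t).1 ht).2, fun w hw hwr => ?_⟩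
    simp only [gadgetRel, pair_inj, num_inj] at hwr
    simp at hwr
    obtain ⟨s, hs, -, rfl, hst⟩ := hwr
    exact hmin s ((hB s).2 ⟨hs, hw⟩) hst
  have hB0 : ∀ t ∈ T, pair (num 0) t ∉ y := fun t ht h => hBne ⟨t, (hB t).2 ⟨ht, h⟩⟩
  obtain ⟨S, hS⟩ := exists_sep N fun n => pair (num 1 : M) n ∈ y ∨ pair (num 2 : M) n ∈ y ∨
    pair (num 3 : M) n ∈ y ∨ ∃ m ∈ N, pair (num 4 : M) (pair n m) ∈ y
  obtain ⟨n, hn, hmin⟩ := hr S (fun n hn => ((hS n).1 hn).1) (by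
    obtain ⟨w, hw⟩ := hne
    obtain ⟨t, ht, rfl⟩ | ⟨n, hn, rfl | rfl | rfl | ⟨m, hm, rfl⟩⟩ := (hz w).1 (hy w hw)
    · exact absurd hw (hB0 t ht)
    all_goals exact ⟨n, (hS n).2 ⟨hn, by grind⟩⟩)
  have h1 : ∀ m ∈ N, pair m n ∈ r → pair (num 1) m ∉ y := fun m hm hmr h =>
    hmin m ((hS m).2 ⟨hm, Or.inl h⟩) hmr
  have h2 : ∀ m ∈ N, pair m n ∈ r → pair (num 2) m ∉ y := fun m hm hmr h =>
    hmin m ((hS m).2 ⟨hm, Or.inr (Or.inl h)⟩) hmr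
  have hN0 : ∀ n ∈ N, pair (num 0) (upair (emp M) n) ∉ y := fun n hn => hB0 _ (hN n hn)
  obtain ⟨hnN, hn'⟩ := (hS n).1 hn
  by_cases h3 : pair (num 3) n ∈ y
  · refine ⟨_, h3, fun w hw hwr => ?_⟩
    simp only [gadgetRel, pair_inj, num_inj] at hwr
    simp at hwr
    grind
  by_cases h4 : ∃ m ∈ N, pair (num 4) (pair n m) ∈ y
  · obtain ⟨m, hm, h4⟩ := h4
    refine ⟨_, h4, fun w hw hwr => ?_⟩
    simp only [gadgetRel, pair_inj, num_inj] at hwr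
    simp at hwr
    grind
  · obtain hn' | hn' : pair (num 1) n ∈ y ∨ pair (num 2) n ∈ y := by grind
    all_goals
      refine ⟨_, hn', fun w hw hwr => ?_⟩
      simp only [gadgetRel, pair_inj, num_inj] at hwr
      simp at hwr
      grind

open Classical in
/-- The value of a well founded game: the positions in `ℓ` are conjunctions and the other positions
are disjunctions of the positions below them. -/
theorem exists_gameValue (N r ℓ : M) (hr : WFOn N fun m n => pair m n ∈ r) :
    ∃ W : M, ∀ n ∈ N, n ∈ W ↔ if n ∈ ℓ then ∀ m ∈ N, pair m n ∈ r → m ∈ W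
      else ∃ m ∈ N, pair m n ∈ r ∧ m ∈ W := by
  -- `T` is a transitive set containing all the tags `{∅, n}`.
  obtain ⟨a, ha⟩ := exists_union N (upair (emp M) (emp M))
  obtain ⟨b, hb⟩ := exists_finitePowerset a
  obtain ⟨T, hT, hbT⟩ := exists_transitive_superset b
  have hN : ∀ n ∈ N, upair (emp M) n ∈ T := fun n hn =>
    hbT _ (hb _ ((ha _).2 (by simp)) _ ((ha _).2 (Or.inl hn)))
  obtain ⟨z, hz⟩ := exists_gadgetNodes T N
  obtain ⟨Y, F, π, hY, hF, hπ⟩ := exists_collapse z _ (gadgetRel_wf (ℓ := ℓ) hN hr hz)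
  have z0 : ∀ t ∈ T, pair (num 0) t ∈ z := fun t ht => (hz _).2 (by simp [ht])
  have z1 : ∀ n ∈ N, pair (num 1) n ∈ z := fun n hn => (hz _).2 (by simp [hn])
  have z2 : ∀ n ∈ N, pair (num 2) n ∈ z := fun n hn => (hz _).2 (by simp [hn])
  have z3 : ∀ n ∈ N, pair (num 3) n ∈ z := fun n hn => (hz _).2 (by simp [hn])
  have z4 : ∀ n ∈ N, ∀ m ∈ N, pair (num 4) (pair n m) ∈ z :=
    fun n hn m hm => (hz _).2 (by simp [hn, hm])
  -- The collapse is the identity on `T`, by `∈`-induction; the graph `F` makes the set of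
  -- counterexamples available.
  have hπT : ∀ t ∈ T, π (pair (num 0) t) = t := by
    obtain ⟨B, hB⟩ := exists_sep T fun t => pair (pair (num 0 : M) t) t ∉ F
    by_contra! hcon
    obtain ⟨t, ht, hmin⟩ := exists_minimal_mem (x := B) (by
      obtain ⟨t, ht, h⟩ := hcon
      exact ⟨t, (hB t).2 ⟨ht, by rw [hF _ (z0 t ht)]; exact h.symm⟩⟩)
    obtain ⟨ht, htF⟩ := (hB t).1 ht
    rw [hF _ (z0 t ht)] at htF
    have hmin' : ∀ s ∈ t, π (pair (num 0) s) = s := by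
      intro s hs
      by_contra h
      refine hmin s ((hB s).2 ⟨hT t ht s hs, ?_⟩) hs
      rw [hF _ (z0 s (hT t ht s hs))]
      exact fun h' => h h'.symm
    refine htF (model_ext fun w => ?_)
    rw [hπ _ (z0 t ht)]
    constructor
    · intro hw
      exact ⟨_, z0 w (hT t ht w hw), Or.inl ⟨w, hT t ht w hw, t, ht, rfl, rfl, hw⟩,
        (hmin' w hw).symm⟩
    · rintro ⟨v, hv, hvr, rfl⟩
      simp only [gadgetRel, pair_inj, num_inj] at hvr
      simp at hvr
      obtain ⟨s, hs, -, rfl, hst⟩ := hvr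
      rwa [hmin' s hst]
  have z0' : ∀ n ∈ N, pair (num 0) (upair (emp M) n) ∈ z := fun n hn => z0 _ (hN n hn)
  have hπT' : ∀ n ∈ N, π (pair (num 0) (upair (emp M) n)) = upair (emp M) n :=
    fun n hn => hπT _ (hN n hn)
  have hg : IsGadget N r ℓ (fun n => π (pair (num 1) n)) (fun n => π (pair (num 2) n))
      (fun n => π (pair (num 3) n)) (fun n m => π (pair (num 4) (pair n m))) := by
    constructor
    · intro n hn w
      rw [hπ _ (z1 n hn)]
      simp only [gadgetRel, pair_inj, num_inj]
      simp
      constructor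
      · rintro ⟨v, -, h, rfl⟩
        clear hN hF hT ha hb hbT hY hz hπ hr z0 hπT z1 z2 z3 z4 z0'
        grind
      · rintro (rfl | ⟨hl, m, hm, hmr, rfl⟩ | ⟨hl, ⟨m, hm, hmr, rfl⟩ | rfl⟩)
        · exact ⟨_, z0' n hn, by simp [*], (hπT' n hn).symm⟩
        · exact ⟨_, z1 m hm, by simp [*], rfl⟩
        · exact ⟨_, z4 n hn m hm, by simp [*], rfl⟩
        · exact ⟨_, z3 n hn, by simp [*], rfl⟩
    · intro n hn w
      rw [hπ _ (z2 n hn)]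
      simp only [gadgetRel, pair_inj, num_inj]
      simp
      constructor
      · rintro ⟨v, -, h, rfl⟩
        clear hN hF hT ha hb hbT hY hz hπ hr z0 hπT z1 z2 z3 z4 z0'
        grind
      · rintro (rfl | ⟨hl, m, hm, hmr, rfl⟩ | ⟨hl, m, hm, hmr, rfl⟩)
        · exact ⟨_, z0' n hn, by simp [*], (hπT' n hn).symm⟩
        · exact ⟨_, z2 m hm, by simp [*], rfl⟩
        · exact ⟨_, z4 n hn m hm, by simp [*], rfl⟩
    · intro n hn w
      rw [hπ _ (z3 n hn)]
      simp only [gadgetRel, pair_inj, num_inj]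
      simp
      constructor
      · rintro ⟨v, -, h, rfl⟩
        clear hN hF hT ha hb hbT hY hz hπ hr z0 hπT z1 z2 z3 z4 z0'
        grind
      · rintro (rfl | ⟨m, hm, hmr, rfl⟩)
        · exact ⟨_, z0' n hn, by simp [*], (hπT' n hn).symm⟩
        · exact ⟨_, z1 m hm, by simp [*], rfl⟩
    · intro n hn m hm w
      rw [hπ _ (z4 n hn m hm)]
      simp only [gadgetRel, pair_inj, num_inj]
      simp
      constructor
      · rintro ⟨v, -, h, rfl⟩
        clear hN hF hT ha hb hbT hY hz hπ hr z0 hπT z1 z2 z3 z4 z0'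
        grind
      · rintro (rfl | ⟨j, hj, hjr, hjm, rfl⟩ | ⟨hmr, rfl⟩)
        · exact ⟨_, z0' n hn, by simp [*], (hπT' n hn).symm⟩
        · exact ⟨_, z1 j hj, by simp [*], rfl⟩
        · exact ⟨_, z2 m hm, by simp [*], rfl⟩
  -- Equality of the two collapsed sets is `Δ₀` in the parameters `Y` and `F`.
  obtain ⟨W, hW⟩ := exists_sep N fun n =>
    ∃ w ∈ Y, pair (pair (num 1 : M) n) w ∈ F ∧ pair (pair (num 2 : M) n) w ∈ F
  have hW' : ∀ n ∈ N, n ∈ W ↔ π (pair (num 1) n) = π (pair (num 2) n) := by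
    intro n hn
    rw [hW]
    constructor
    · rintro ⟨-, w, -, h1, h2⟩
      rw [← (hF _ (z1 n hn) w).1 h1, ← (hF _ (z2 n hn) w).1 h2]
    · intro h
      exact ⟨hn, _, hY _ (z1 n hn), (hF _ (z1 n hn) _).2 rfl, (hF _ (z2 n hn) _).2 h⟩
  refine ⟨W, fun n hn => ?_⟩
  rw [hW' n hn, hg.eq_iff hn]
  split_ifs
  · exact forall₃_congr fun m hm _ => (hW' m hm).symm
  · exact exists_congr fun m => and_congr_right fun hm => and_congr_right fun _ => (hW' m hm).symm

end Game

/-! ### `Δ₀` formulas evaluated by a game -/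

section Eval

variable {M : Type} [ModelC M]

/-! ### Relativized satisfaction -/

/-- Satisfaction with the quantifiers restricted to the elements of `D`. -/
def SatIn (D : M) : (ℕ → M) → Fml → Prop
  | v, .mem i j => v i ∈ v j
  | v, .eq i j => v i = v j
  | _, .bot => False
  | v, .imp φ ψ => SatIn D v φ → SatIn D v ψ
  | v, .all φ => ∀ x ∈ D, SatIn D (scons x v) φ

/-- A bounded quantifier ranges over elements of values, so the values need only be subsets of `D`.
This admits `H_{≺ s}` as a value. -/
theorem sat_iff_satIn {D : M} (hD : ∀ z ∈ D, ∀ w ∈ z, w ∈ D) {φ : Fml} (h : IsDelta0 φ) :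
    ∀ {v : ℕ → M}, (∀ i, ∀ z ∈ v i, z ∈ D) → (MSat v φ ↔ SatIn D v φ) := by
  have hs : ∀ {v : ℕ → M} {x}, (∀ i, ∀ z ∈ v i, z ∈ D) → x ∈ D →
      ∀ i, ∀ z ∈ scons x v i, z ∈ D := by
    intro v x hv hx i
    cases i
    exacts [hD x hx, hv _]
  induction h with
  | mem i j => intros; rfl
  | eq i j => intros; rfl
  | bot => intros; rfl
  | imp _ _ ih1 ih2 =>
    intro v hv
    simp only [MSat, Sat, SatIn] at ih1 ih2 ⊢
    rw [ih1 hv, ih2 hv]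
  | allIn y _ ih =>
    intro v hv
    rw [MSat, sat_allIn]
    simp only [allIn, SatIn, scons_zero, scons_succ]
    refine forall_congr' fun x => ?_
    exact ⟨fun h hx hxy => (ih (hs hv hx)).1 (h hxy),
      fun h hxy => (ih (hs hv (hv y x hxy))).2 (h (hv y x hxy) hxy)⟩
  | exIn y _ ih =>
    intro v hv
    rw [MSat, sat_exIn]
    simp only [exIn, ex, conj, neg, SatIn, scons_zero, scons_succ]
    constructor
    · rintro ⟨x, hxy, h⟩ h'
      exact h' x (hv y x hxy) fun h'' => h'' hxy ((ih (hs hv (hv y x hxy))).1 h)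
    · intro h
      by_contra! hcon
      exact h fun x hx h' => h' fun hxy h'' => hcon x hxy ((ih (hs hv hx)).2 h'')

/-! ### Subformulas with the number of variables bound above them -/

/-- The subformulas of a formula; a subformula below `d` quantifiers is paired with `k + d`. -/
def Fml.subs : Fml → ℕ → List (Fml × ℕ)
  | .mem i j, k => [(.mem i j, k)]
  | .eq i j, k => [(.eq i j, k)]
  | .bot, k => [(.bot, k)]
  | .imp φ ψ, k => (.imp φ ψ, k) :: (subs φ k ++ subs ψ k)
  | .all φ, k => (.all φ, k) :: subs φ (k + 1)

theorem Fml.self_mem_subs (φ : Fml) (k : ℕ) : (φ, k) ∈ subs φ k := by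
  cases φ <;> simp [subs]

theorem Fml.subs_trans {φ : Fml} : ∀ {k : ℕ} {χ : Fml} {m : ℕ}, (χ, m) ∈ subs φ k →
    ∀ x ∈ subs χ m, x ∈ subs φ k := by
  induction φ with
  | mem | eq | bot => intro k χ m h; simp [subs] at h; simp [h, subs]
  | imp φ ψ ih1 ih2 =>
    intro k χ m h x hx
    simp only [subs, List.mem_cons, List.mem_append] at h ⊢
    obtain h | h | h := h
    · simp only [Prod.mk.injEq] at h
      rw [h.1, h.2] at hx
      simpa [subs] using hx
    · exact Or.inr (Or.inl (ih1 h x hx))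
    · exact Or.inr (Or.inr (ih2 h x hx))
  | all φ ih =>
    intro k χ m h x hx
    simp only [subs, List.mem_cons] at h ⊢
    obtain h | h := h
    · simp only [Prod.mk.injEq] at h
      rw [h.1, h.2] at hx
      simpa [subs] using hx
    · exact Or.inr (ih h x hx)

/-- The counter grows with each quantifier and so keeps pointing at the shifted variable `v`. -/
theorem Fml.OnlyAsClass.subs {φ : Fml} : ∀ {k : ℕ} {χ : Fml} {m : ℕ}, OnlyAsClass k φ →
    (χ, m) ∈ subs φ k → OnlyAsClass m χ := by
  induction φ with
  | mem | eq | bot => intro k χ m h h'; simp [Fml.subs] at h'; rwa [h'.1, h'.2]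
  | imp φ ψ ih1 ih2 =>
    intro k χ m h h'
    simp only [Fml.subs, List.mem_cons, List.mem_append, Prod.mk.injEq] at h'
    obtain h' | h' | h' := h'
    · rwa [h'.1, h'.2]
    · exact ih1 h.1 h'
    · exact ih2 h.2 h'
  | all φ ih =>
    intro k χ m h h'
    simp only [Fml.subs, List.mem_cons, Prod.mk.injEq] at h'
    obtain h' | h' := h'
    · rwa [h'.1, h'.2]
    · exact ih h h'

/-! ### Finite sequences -/

/-- The assignment that begins with the list `l` and continues with `v`. -/
def app {α : Type} (l : List α) (v : ℕ → α) : ℕ → α := l.foldr scons v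

/-- Only the variable `l.length` sees the entry after `l`; every other variable is unaffected when
`H_{≺ s}` is replaced by `∅`. -/
theorem app_scons_congr {α : Type} {v : ℕ → α} {x y : α} : ∀ {l : List α} {i : ℕ}, i ≠ l.length →
    app l (scons x v) i = app l (scons y v) i
  | [], 0, h => absurd rfl h
  | [], _ + 1, _ => rfl
  | _ :: _, 0, _ => rfl
  | _ :: l, i + 1, h => app_scons_congr (l := l) (i := i) fun h' => h (by simp [h'])

theorem app_length {α : Type} {v : ℕ → α} {x : α} : ∀ {l : List α}, app l (scons x v) l.length = x
  | [] => rfl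
  | _ :: l => app_length (l := l)

theorem app_subset {D : M} (hD : ∀ z ∈ D, ∀ w ∈ z, w ∈ D) {v : ℕ → M}
    (hv : ∀ i, ∀ z ∈ v i, z ∈ D) : ∀ {l : List M}, (∀ x ∈ l, x ∈ D) →
    ∀ i, ∀ z ∈ app l v i, z ∈ D
  | [], _, i => hv i
  | x :: _, h, 0 => hD x (h x (by simp))
  | _ :: _, h, i + 1 => app_subset hD hv (fun y hy => h y (by simp [hy])) i

/-- The set coding a list. -/
noncomputable def tup : List M → M
  | [] => emp M
  | x :: l => pair x (tup l)

theorem pair_ne_emp (x y : M) : pair x y ≠ emp M := fun h =>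
  notMem_emp (upair x x) (by rw [← h]; exact mem_upair.2 (Or.inl rfl))

@[simp] theorem tup_inj : ∀ {l m : List M}, tup l = tup m ↔ l = m
  | [], [] => by simp
  | [], _ :: _ => by simpa [tup] using (pair_ne_emp _ _).symm
  | _ :: _, [] => by simpa [tup] using pair_ne_emp _ _
  | _ :: l, _ :: m => by simp [tup, tup_inj (l := l) (m := m)]

theorem exists_tuples (D : M) (n : ℕ) :
    ∃ U : M, ∀ l : List M, l.length ≤ n → (∀ x ∈ l, x ∈ D) → tup l ∈ U := by
  induction n with
  | zero =>
    refine ⟨upair (emp M) (emp M), fun l hl _ => ?_⟩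
    rw [List.eq_nil_of_length_eq_zero (Nat.le_zero.1 hl)]
    simp [tup]
  | succ n ih =>
    obtain ⟨U, hU⟩ := ih
    obtain ⟨V, hV⟩ := exists_union U (prod D U)
    refine ⟨V, fun l hl hlD => (hV _).2 ?_⟩
    cases l with
    | nil => exact Or.inl (hU [] (by simp) (by simp))
    | cons x l =>
      refine Or.inr (pair_mem_prod.2 ⟨hlD x (by simp), hU l (by simpa using hl) fun y hy => ?_⟩)
      exact hlD y (by simp [hy])

theorem SF.tup {Γ : Type} [Ctx M Γ] : ∀ {ts : List (Γ → M)}, (∀ t ∈ ts, Tm t) →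
    SF fun γ => tup (ts.map fun t => t γ)
  | [], _ => (inferInstance : SF fun _ : Γ => emp M)
  | t :: ts, h => by
    have := h t (by simp)
    have := SF.tup (ts := ts) fun s hs => h s (by simp [hs])
    exact (inferInstance : SF fun γ => SetTh.pair (t γ) (SetTh.tup (ts.map fun t => t γ)))

theorem Tm.app {K Γ : Type} [Ctx K Γ] (v : ℕ → K) : ∀ {ts : List (Γ → K)}, (∀ t ∈ ts, Tm t) →
    ∀ i, Tm fun γ => app (ts.map fun t => t γ) v i
  | [], _, i => (inferInstance : Tm fun _ : Γ => v i)
  | t :: _, h, 0 => h t (by simp)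
  | _ :: ts, h, i + 1 => Tm.app v (ts := ts) (fun s hs => h s (by simp [hs])) i

/-- For a fixed external length this is a block of `k` quantifiers bounded by `D`. The hypothesis
speaks of all contexts over `Γ` so that the induction can add variables. -/
theorem D0.exists_list (D : M) (k : ℕ) : ∀ {Γ : Type} [Ctx M Γ] {Q : Γ → List M → Prop},
    (∀ {Δ : Type} [Ctx M Δ] (σ : Δ → Γ) [Proj M σ] (ts : List (Δ → M)), (∀ t ∈ ts, Tm t) →
      ts.length = k → D0 (M := M) fun δ => Q (σ δ) (ts.map fun t => t δ)) →
    D0 (M := M) fun γ => ∃ l : List M, l.length = k ∧ (∀ x ∈ l, x ∈ D) ∧ Q γ l := by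
  induction k with
  | zero =>
    intro Γ _ Q h
    refine (h (fun γ => γ) [] (by simp) rfl).congr fun γ => ?_
    simp
  | succ k ih =>
    intro Γ _ Q h
    have := ih (Γ := Γ × M) (Q := fun p l => Q p.1 (p.2 :: l)) fun σ _ ts hts hl =>
      h (fun δ => (σ δ).1) ((fun δ => (σ δ).2) :: ts)
        (by rintro t (_ | ⟨_, ht⟩); exacts [inferInstance, hts t ht]) (by simp [hl])
    refine (D0.ex (M := M) (t := fun _ : Γ => D) (Q := fun γ x => ∃ l : List M, l.length = k ∧
      (∀ y ∈ l, y ∈ D) ∧ Q γ (x :: l))).congr fun γ => ?_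
    constructor
    · rintro ⟨_ | ⟨x, l⟩, h1, h2, h3⟩
      · simp at h1
      · exact ⟨x, h2 x (by simp), l, by simpa using h1, fun y hy => h2 y (by simp [hy]), h3⟩
    · rintro ⟨x, hx, l, h1, h2, h3⟩
      exact ⟨x :: l, by simp [h1], by simpa using ⟨hx, h2⟩, h3⟩

/-! ### The evaluation game -/

/-- The position in which it is claimed that the subformula `χ` is true (if `b`) or false under
the assignment `l`, at the stage `s` of the recursion. -/
noncomputable def nd (b : Bool) (χ : Fml) (s : M) (l : List M) : M :=
  pair (num b.toNat) (pair (num χ.code) (pair s (tup l)))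

@[simp] theorem nd_inj {b b' : Bool} {χ χ' : Fml} {s s' : M} {l l' : List M} :
    nd b χ s l = nd b' χ' s' l' ↔ b = b' ∧ χ = χ' ∧ s = s' ∧ l = l' := by
  cases b <;> cases b' <;> simp [nd, code_injective.eq_iff]

/-- The moves of the evaluation game. -/
def Move (ψ : Fml) (a X lt D : M) (v : ℕ → M) : Fml → ℕ → Bool → M → List M → M → Prop
  -- An implication is true if its premise is false or its conclusion true, and false if its premise
  -- is true and its conclusion false.
  | .imp φ χ, _, b, s, l, m => m = nd (!b) φ s l ∨ m = nd b χ s l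
  | .all φ, _, b, s, l, m => ∃ x ∈ D, m = nd b φ s (x :: l)
  | .mem i j, k, b, s, l, m => j = k ∧ ∃ u ∈ a, ∃ t ∈ X, pair t s ∈ lt ∧ app l v i = pair u t ∧
      m = nd b ψ t [u]
  | _, _, _, _, _, _ => False

/-- The conjunctive positions of the evaluation game. -/
def IsConj (v : ℕ → M) : Fml → ℕ → Bool → List M → Prop
  | .imp _ _, _, b, _ => b = false
  | .all _, _, b, _ => b = true
  -- When `j = k` the atom is `x ∈ v`, whose truth is existential and whose falsity is universal.
  -- Other atoms have no moves: a correct claim becomes an empty conjunction and is won, a wrong one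
  -- an empty disjunction and is lost.
  | .mem i j, k, b, l => j = k ∧ b = false ∨ ¬ j = k ∧ (b = true ↔ app l v i ∈ app l v j)
  | .eq i j, _, b, l => b = true ↔ app l v i = app l v j
  | .bot, _, b, _ => b = false

/-- `n` is a position of the evaluation game of `ψ` that satisfies `P`. -/
def Pos (ψ : Fml) (X D : M) (P : Fml → ℕ → Bool → M → List M → Prop) (n : M) : Prop :=
  ∃ x, x ∈ subs ψ 1 ∧ ∃ b, b ∈ [true, false] ∧ ∃ s, s ∈ X ∧ ∃ l : List M, l.length = x.2 ∧
    (∀ y ∈ l, y ∈ D) ∧ (n = nd b x.1 s l ∧ P x.1 x.2 b s l)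

theorem pos_nd {ψ : Fml} {X D : M} {P : Fml → ℕ → Bool → M → List M → Prop} {b : Bool} {χ : Fml}
    {s : M} {l : List M} (hχ : (χ, l.length) ∈ subs ψ 1) (hs : s ∈ X) (hl : ∀ y ∈ l, y ∈ D) :
    Pos ψ X D P (nd b χ s l) ↔ P χ l.length b s l := by
  constructor
  · rintro ⟨⟨χ', k⟩, -, b', -, s', -, l', h1, -, h2, h3⟩
    rw [nd_inj] at h2
    obtain ⟨rfl, rfl, rfl, rfl⟩ := h2
    dsimp only at h1 h3
    rwa [h1]
  · intro h
    exact ⟨_, hχ, b, by cases b <;> simp, s, hs, l, rfl, hl, rfl, h⟩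

theorem SF.nd {Γ : Type} [Ctx M Γ] (b : Bool) (χ : Fml) (s : Γ → M) [Tm s] {ts : List (Γ → M)}
    (hts : ∀ t ∈ ts, Tm t) : SF fun γ => nd b χ (s γ) (ts.map fun t => t γ) := by
  have := SF.tup hts
  unfold SetTh.nd
  infer_instance

/-- The subformula and the truth claim range over external finite lists, so the predicate is a
finite disjunction and no internal satisfaction relation is needed. -/
theorem D0.pos {ψ : Fml} {X D : M} {Γ : Type} [Ctx M Γ]
    {P : Γ → Fml → ℕ → Bool → M → List M → Prop} (n : Γ → M) [Tm n]
    (hP : ∀ {Δ : Type} [Ctx M Δ] (σ : Δ → Γ) [Proj M σ] (χ : Fml) (k : ℕ) (b : Bool) (s : Δ → M)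
      [Tm s] (ts : List (Δ → M)), (∀ t ∈ ts, Tm t) →
      D0 (M := M) fun δ => P (σ δ) χ k b (s δ) (ts.map fun t => t δ)) :
    D0 (M := M) fun γ => Pos ψ X D (P γ) (n γ) := by
  refine D0.exists_mem_list _ fun x _ => D0.exists_mem_list _ fun b _ => ?_
  refine @D0.ex _ _ _ _ (fun _ => X) (fun γ s => _) _ ?_
  refine D0.exists_list D _ fun σ _ ts hts _ => ?_
  have := SF.nd b x.1 (fun δ => (σ δ).2) hts
  have := hP (fun δ => (σ δ).1) x.1 x.2 b (fun δ => (σ δ).2) ts hts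
  have := Tm.comp n fun δ => (σ δ).1
  infer_instance

theorem D0.isConj {Γ : Type} [Ctx M Γ] (v : ℕ → M) (χ : Fml) (k : ℕ) (b : Bool)
    {ts : List (Γ → M)} (hts : ∀ t ∈ ts, Tm t) :
    D0 (M := M) fun γ => IsConj v χ k b (ts.map fun t => t γ) := by
  have := Tm.app v hts
  have hc : ∀ p : Prop, D0 (M := M) (fun _ : Γ => p) := D0.const
  cases χ <;> unfold IsConj <;> infer_instance

theorem D0.move {Γ : Type} [Ctx M Γ] (ψ : Fml) (a X lt D : M) (v : ℕ → M) (χ : Fml) (k : ℕ)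
    (b : Bool) (s : Γ → M) [Tm s] {ts : List (Γ → M)} (hts : ∀ t ∈ ts, Tm t) (m : Γ → M) [Tm m] :
    D0 (M := M) fun γ => Move ψ a X lt D v χ k b (s γ) (ts.map fun t => t γ) (m γ) := by
  have hc : ∀ p : Prop, D0 (M := M) (fun _ : Γ => p) := D0.const
  cases χ with
  | imp φ χ =>
    have := SF.nd (!b) φ s hts
    have := SF.nd b χ s hts
    unfold Move
    infer_instance
  | all φ =>
    have hts' : ∀ t ∈ ts.map (fun t (p : Γ × M) => t p.1), Tm t := by
      intro t ht
      obtain ⟨t', ht', rfl⟩ := List.mem_map.1 ht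
      have := hts t' ht'
      exact Tm.comp t' Prod.fst
    have := Tm.comp s (Prod.fst : Γ × M → Γ)
    have := Tm.comp m (Prod.fst : Γ × M → Γ)
    have := SF.nd (ts := Prod.snd :: ts.map (fun t (p : Γ × M) => t p.1)) b φ (fun p => s p.1)
      (by rintro t (_ | ⟨_, ht⟩); exacts [inferInstance, hts' t ht])
    simp only [List.map_cons, List.map_map, Function.comp_def] at this
    unfold Move
    infer_instance
  | mem i j =>
    have := Tm.app v hts i
    have h1 := Tm.comp s (fun p : (Γ × M) × M => p.1.1)
    have h2 := Tm.comp m (fun p : (Γ × M) × M => p.1.1)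
    have h3 := Tm.comp (fun γ => SetTh.app (ts.map fun t => t γ) v i) (fun p : (Γ × M) × M => p.1.1)
    have h4 := SF.nd (ts := [fun p : (Γ × M) × M => p.1.2]) b ψ Prod.snd (by
      intro t ht
      rw [List.mem_singleton] at ht
      subst ht
      infer_instance)
    simp only [List.map_cons, List.map_nil] at h4
    unfold Move
    infer_instance
  | _ => exact hc False

end Eval

/-! ### The evaluation game and transfinite recursion -/

section Recursion

variable {M : Type} [ModelC M]

/-- The game is well founded because of this descent: a move may return to the whole of `ψ`, but
only at an earlier stage. -/
theorem Move.spec {ψ : Fml} {a X lt D : M} {v : ℕ → M} {χ : Fml} {b : Bool} {s m : M} {l : List M}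
    (ha : ∀ z ∈ a, z ∈ D) (hχ : (χ, l.length) ∈ subs ψ 1) (hs : s ∈ X) (hl : ∀ y ∈ l, y ∈ D)
    (h : Move ψ a X lt D v χ l.length b s l m) :
    ∃ b' χ' s' l', m = nd b' χ' s' l' ∧ (χ', l'.length) ∈ subs ψ 1 ∧ s' ∈ X ∧ (∀ y ∈ l', y ∈ D) ∧
      (s' = s ∧ sizeOf χ' < sizeOf χ ∨ pair s' s ∈ lt) := by
  have htr := subs_trans hχ
  cases χ with
  | imp φ χ =>
    have h1 : (φ, l.length) ∈ subs ψ 1 := htr _ (by simp [subs, self_mem_subs])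
    have h2 : (χ, l.length) ∈ subs ψ 1 := htr _ (by simp [subs, self_mem_subs])
    obtain h | h := h
    · exact ⟨_, _, _, _, h, h1, hs, hl, Or.inl ⟨rfl, by simp; omega⟩⟩
    · exact ⟨_, _, _, _, h, h2, hs, hl, Or.inl ⟨rfl, by simp⟩⟩
  | all φ =>
    obtain ⟨x, hx, h⟩ := h
    exact ⟨_, _, _, _, h, htr _ (by simp [subs, self_mem_subs]), hs, by simpa using ⟨hx, hl⟩,
      Or.inl ⟨rfl, by simp⟩⟩
  | mem i j =>
    obtain ⟨-, u, hu, t, ht, hts, -, h⟩ := h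
    exact ⟨_, _, _, _, h, self_mem_subs _ _, ht, by simpa using ha u hu, Or.inr hts⟩
  | eq | bot => exact h.elim

/-- A set of positions without a minimal element has a set of stages, by Separation. At a
`≺`-minimal stage every position would have a move to a smaller formula, against external induction
on size; transitivity of `≺` is not needed. -/
theorem wfOn_of_pos {ψ : Fml} {a X lt D B C U N r : M} {v : ℕ → M} (ha : ∀ z ∈ a, z ∈ D)
    (hwf : WFOn X fun t s => pair t s ∈ lt)
    (hN : ∀ n ∈ N, n ∈ prod B (prod C (prod X U)))
    (hr : ∀ m ∈ N, ∀ n ∈ N, pair m n ∈ r →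
      Pos ψ X D (fun χ k b s l => Move ψ a X lt D v χ k b s l m) n) :
    WFOn N fun m n => pair m n ∈ r := by
  intro y hy hne
  obtain ⟨S, hS⟩ := exists_sep X fun s => ∃ b ∈ B, ∃ c ∈ C, ∃ t ∈ U, pair b (pair c (pair s t)) ∈ y
  have hS' : ∀ b χ s l, nd b χ s l ∈ y → s ∈ S := by
    intro b χ s l h
    have h1 := hN _ (hy _ h)
    simp only [nd, pair_mem_prod] at h1
    exact (hS s).2 ⟨h1.2.2.1, _, h1.1, _, h1.2.1, _, h1.2.2.2, h⟩
  by_contra! hcon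
  have hpos : ∀ n ∈ y, ∃ m ∈ y, Pos ψ X D (fun χ k b s l => Move ψ a X lt D v χ k b s l m) n := by
    intro n hn
    obtain ⟨m, hm, hmr⟩ := hcon n hn
    exact ⟨m, hm, hr m (hy m hm) n (hy n hn) hmr⟩
  obtain ⟨s, hs, hmin⟩ := hwf S (fun s hs => ((hS s).1 hs).1) (by
    obtain ⟨n, hn⟩ := hne
    obtain ⟨m, -, x, -, b, -, s, -, l, -, -, rfl, -⟩ := hpos n hn
    exact ⟨s, hS' _ _ _ _ hn⟩)
  have key : ∀ k : ℕ, ∀ b χ l, sizeOf χ = k → nd b χ s l ∉ y := by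
    intro k
    induction k using Nat.strong_induction_on with
    | _ k ih =>
      intro b χ l hk hn
      obtain ⟨m, hm, ⟨χ', _⟩, hχ, b', -, s', hsX, l', rfl, hl, hnd, hmove⟩ := hpos _ hn
      rw [nd_inj] at hnd
      obtain ⟨rfl, rfl, rfl, rfl⟩ := hnd
      obtain ⟨b'', χ'', s'', l'', rfl, -, -, -, h⟩ := hmove.spec ha hχ hsX hl
      obtain ⟨rfl, h⟩ | h := h
      · exact ih _ (by rw [← hk]; exact h) _ _ _ rfl hm
      · exact hmin _ (hS' _ _ _ _ hm) h
  obtain ⟨hsX, b, -, c, -, t, -, hn⟩ := (hS s).1 hs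
  obtain ⟨m, -, x, -, b', -, s', -, l, -, -, h, -⟩ := hpos _ hn
  have h' := h
  simp only [nd, pair_inj] at h'
  obtain ⟨-, -, rfl, -⟩ := h'
  exact key _ _ _ _ rfl (h ▸ hn)

open Classical in
/-- The values of the positions of the evaluation game form a set. -/
theorem exists_evaluation (ψ : Fml) {a X lt D : M} (v : ℕ → M) (ha : ∀ z ∈ a, z ∈ D)
    (hwf : WFOn X fun t s => pair t s ∈ lt) :
    ∃ W : M, ∀ b χ s l, (χ, l.length) ∈ subs ψ 1 → s ∈ X → (∀ y ∈ l, y ∈ D) →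
      (nd b χ s l ∈ W ↔ if IsConj v χ l.length b l
        then ∀ m, Move ψ a X lt D v χ l.length b s l m → m ∈ W
        else ∃ m, Move ψ a X lt D v χ l.length b s l m ∧ m ∈ W) := by
  obtain ⟨B, hB⟩ := exists_set_of_list (M := M) [num 0, num 1]
  obtain ⟨C, hC⟩ := exists_set_of_list (M := M) ((subs ψ 1).map fun x => num x.1.code)
  obtain ⟨k, hk⟩ : ∃ k, ∀ x ∈ subs ψ 1, x.2 ≤ k :=
    ⟨((subs ψ 1).map Prod.snd).sum, fun x hx => List.le_sum_of_mem (List.mem_map_of_mem hx)⟩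
  obtain ⟨U, hU⟩ := exists_tuples D k
  set N := prod B (prod C (prod X U)) with hNdef
  have hN : ∀ {b χ s l}, (χ, l.length) ∈ subs ψ 1 → s ∈ X → (∀ y ∈ l, y ∈ D) →
      nd b χ s l ∈ N := by
    intro b χ s l hχ hs hl
    simp only [hNdef, nd, pair_mem_prod]
    refine ⟨(hB _).2 (by cases b <;> simp), (hC _).2 (List.mem_map_of_mem hχ), hs,
      hU l (hk _ hχ) hl⟩
  have hrel : D0Rel fun m n : M => Pos ψ X D (fun χ k b s l => Move ψ a X lt D v χ k b s l m) n :=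
    ⟨D0.pos (P := fun (p : (Unit × M) × M) χ k b s l => Move ψ a X lt D v χ k b s l p.1.2) Prod.snd
      fun σ _ χ k b s _ ts hts => D0.move ψ a X lt D v χ k b s hts fun δ => (σ δ).1.2⟩
  obtain ⟨r, -, hr⟩ := @exists_rel M _ N _ hrel
  have hconj : D0 (M := M) fun p : Unit × M =>
      Pos ψ X D (fun χ k b _ l => IsConj v χ k b l) p.2 :=
    D0.pos (P := fun _ χ k b _ l => IsConj v χ k b l) Prod.snd
      fun σ _ χ k b s _ ts hts => D0.isConj v χ k b hts
  obtain ⟨ℓ, hℓ⟩ := exists_sep N (fun n => Pos ψ X D (fun χ k b _ l => IsConj v χ k b l) n)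
  obtain ⟨W, hW⟩ := exists_gameValue N r ℓ
    (wfOn_of_pos ha hwf (fun _ h => h) fun m hm n hn => (hr m hm n hn).1)
  refine ⟨W, fun b χ s l hχ hs hl => ?_⟩
  have hn := hN (b := b) hχ hs hl
  have hmove : ∀ m, Move ψ a X lt D v χ l.length b s l m → m ∈ N := by
    intro m hm
    obtain ⟨b', χ', s', l', rfl, h1, h2, h3, -⟩ := hm.spec ha hχ hs hl
    exact hN h1 h2 h3
  have hr' : ∀ m ∈ N, pair m (nd b χ s l) ∈ r ↔ Move ψ a X lt D v χ l.length b s l m :=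
    fun m hm => (hr m hm _ hn).trans (pos_nd hχ hs hl)
  have hℓ' : nd b χ s l ∈ ℓ ↔ IsConj v χ l.length b l := by
    rw [hℓ, pos_nd hχ hs hl]
    exact and_iff_right hn
  rw [hW _ hn]
  simp only [hℓ']
  split_ifs
  · exact ⟨fun h m hm => h m (hmove m hm) ((hr' m (hmove m hm)).2 hm),
      fun h m hm hmr => h m ((hr' m hm).1 hmr)⟩
  · exact ⟨fun ⟨m, hm, hmr, hmW⟩ => ⟨m, (hr' m hm).1 hmr, hmW⟩,
      fun ⟨m, hm, hmW⟩ => ⟨m, hmove m hm, (hr' m (hmove m hm)).2 hm, hmW⟩⟩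

/-- The evaluation game is correct at the stage `s`, if it is consistent at the earlier stages. -/
theorem evaluation_correct {ψ : Fml} (hc : OnlyAsClass 1 ψ) {a X lt D W : M} {p : ℕ → M}
    (hW : ∀ b χ s l, (χ, l.length) ∈ subs ψ 1 → s ∈ X → (∀ y ∈ l, y ∈ D) →
      (nd b χ s l ∈ W ↔
        (IsConj (scons (emp M) p) χ l.length b l →
          ∀ m, Move ψ a X lt D (scons (emp M) p) χ l.length b s l m → m ∈ W) ∧
        (¬ IsConj (scons (emp M) p) χ l.length b l →
          ∃ m, Move ψ a X lt D (scons (emp M) p) χ l.length b s l m ∧ m ∈ W)))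
    {s : M} (hs : s ∈ X)
    (hcons : ∀ t ∈ X, pair t s ∈ lt → ∀ u ∈ a, nd false ψ t [u] ∈ W ↔ nd true ψ t [u] ∉ W)
    {w : M} (hw : ∀ q, q ∈ w ↔ ∃ u ∈ a, ∃ t ∈ X, pair t s ∈ lt ∧ q = pair u t ∧
      nd true ψ t [u] ∈ W)
    (χ : Fml) : ∀ (b : Bool) (l : List M), (χ, l.length) ∈ subs ψ 1 → (∀ y ∈ l, y ∈ D) →
      (nd b χ s l ∈ W ↔ (b = true ↔ SatIn D (app l (scons w p)) χ)) := by
  induction χ with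
  | mem i j =>
    intro b l hχ hl
    have hi : i ≠ l.length := hc.subs hχ
    rw [hW b _ s l hχ hs hl]
    simp only [Move, IsConj, SatIn]
    -- The left side of the atom is not `v`, so the game, which holds `∅` in place of `w`, reads it
    -- correctly.
    rw [app_scons_congr (x := w) (y := emp M) hi]
    by_cases hj : j = l.length
    · subst hj
      rw [app_length (x := w), hw]
      -- Only the claim of falsity needs `hcons`, which exchanges winning "false" for losing "true"
      -- at earlier stages.
      cases b
      · simp
        constructor
        · intro h u hu t ht hts he hW'
          exact (hcons t ht hts u hu).1 (h _ u hu t ht hts he rfl) hW'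
        · rintro h m u hu t ht hts he rfl
          exact (hcons t ht hts u hu).2 (h u hu t ht hts he)
      · simp
        constructor
        · rintro ⟨u, t, ⟨hu, ht, hts, he⟩, hm⟩
          exact ⟨u, hu, t, ht, hts, he, hm⟩
        · rintro ⟨u, hu, t, ht, hts, he, hm⟩
          exact ⟨u, t, ⟨hu, ht, hts, he⟩, hm⟩
    · rw [app_scons_congr (x := w) (y := emp M) hj]
      simp [hj]
  | eq i j =>
    intro b l hχ hl
    have hij : i ≠ l.length ∧ j ≠ l.length := hc.subs hχ
    rw [hW b _ s l hχ hs hl]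
    simp only [Move, IsConj, SatIn]
    rw [app_scons_congr (x := w) (y := emp M) hij.1, app_scons_congr (x := w) (y := emp M) hij.2]
    simp
  | bot =>
    intro b l hχ hl
    rw [hW b _ s l hχ hs hl]
    simp [Move, IsConj, SatIn]
  | imp φ θ ih1 ih2 =>
    intro b l hχ hl
    have h1 := fun b => ih1 b l (subs_trans hχ _ (by simp [subs, self_mem_subs])) hl
    have h2 := fun b => ih2 b l (subs_trans hχ _ (by simp [subs, self_mem_subs])) hl
    rw [hW b _ s l hχ hs hl]
    cases b <;> simp [Move, IsConj, SatIn, h1, h2] <;> tauto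
  | all φ ih =>
    intro b l hχ hl
    have h1 : ∀ b, ∀ x ∈ D, nd b φ s (x :: l) ∈ W ↔
        (b = true ↔ SatIn D (scons x (app l (scons w p))) φ) := fun b x hx =>
      ih b (x :: l) (subs_trans hχ _ (by simp [subs, self_mem_subs])) (by simpa using ⟨hx, hl⟩)
    rw [hW b _ s l hχ hs hl]
    cases b
    · simp [Move, IsConj, SatIn]
      constructor
      · rintro ⟨x, hx, hm⟩
        exact ⟨x, hx, by simpa using (h1 _ x hx).1 hm⟩
      · rintro ⟨x, hx, h⟩
        exact ⟨x, hx, (h1 _ x hx).2 (by simpa using h)⟩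
    · simp [Move, IsConj, SatIn]
      constructor
      · intro h x hx
        simpa using (h1 _ x hx).1 (h _ x hx rfl)
      · rintro h m x hx rfl
        exact (h1 _ x hx).2 (by simpa using h x hx)

/-- Transfinite recursion in a model. -/
theorem exists_recursion {ψ : Fml} (hψ : IsDelta0 ψ) (hc : OnlyAsClass 1 ψ) (p : ℕ → M) {a X lt : M}
    (hwf : WFOn X fun t s => pair t s ∈ lt) :
    ∃ H : M, (∀ z ∈ H, ∃ u ∈ a, ∃ s ∈ X, z = pair u s) ∧ ∀ s ∈ X, ∀ c ∈ a, ∃ w : M,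
      (∀ q, q ∈ w ↔ ∃ t, pair t s ∈ lt ∧ ∃ u ∈ a, pair u t ∈ H ∧ q = pair u t) ∧
      (pair c s ∈ H ↔ MSat (scons c (scons w p)) ψ) := by
  -- the parameters that do not occur in the formula are replaced by the empty set
  let p' : ℕ → M := fun i => if i < fvBound ψ then p i else emp M
  have hp' : ∀ c w : M, MSat (scons c (scons w p)) ψ ↔ MSat (scons c (scons w p')) ψ := by
    intro c w
    refine Sat.congr fun i hi => ?_
    match i, hi with
    | 0, _ => rfl
    | 1, _ => rfl
    | i + 2, hi => exact (if_pos (show i < fvBound ψ by omega)).symm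
  obtain ⟨P, hP⟩ := exists_set_of_list ((List.range (fvBound ψ)).map p')
  obtain ⟨Q, hQ⟩ := exists_sUnion P
  obtain ⟨R, hR⟩ := exists_union a (prod a X)
  obtain ⟨S, hS⟩ := exists_union Q R
  -- `D` contains the elements of the parameters, of `a` and of `a × X`, hence those of every `H_{≺
  -- s}`.
  obtain ⟨D, hD, hSD⟩ := exists_transitive_superset S
  have haD : ∀ z ∈ a, z ∈ D := fun z hz => hSD z ((hS z).2 (Or.inr ((hR z).2 (Or.inl hz))))
  have hXD : ∀ z ∈ prod a X, z ∈ D := fun z hz => hSD z ((hS z).2 (Or.inr ((hR z).2 (Or.inr hz))))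
  have hpD : ∀ i, ∀ z ∈ p' i, z ∈ D := by
    intro i z hz
    by_cases hi : i < fvBound ψ
    · refine hSD z ((hS z).2 (Or.inl ((hQ z).2 ⟨p' i, (hP _).2 ?_, hz⟩)))
      exact List.mem_map_of_mem (List.mem_range.2 hi)
    · simp [p', hi] at hz
  obtain ⟨W, hW⟩ := exists_evaluation ψ (scons (emp M) p') haD hwf
  have hSF : ∀ {Γ : Type} [Ctx M Γ] b, SF fun q : (Γ × M) × M => nd b ψ q.1.2 [q.2] := by
    intro Γ _ b
    refine SF.nd (ts := [Prod.snd]) b ψ (fun q : (Γ × M) × M => q.1.2) fun t ht => ?_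
    rw [List.mem_singleton] at ht
    subst ht
    infer_instance
  have hcorrect : ∀ s ∈ X, (∀ t ∈ X, pair t s ∈ lt → ∀ u ∈ a,
      nd false ψ t [u] ∈ W ↔ nd true ψ t [u] ∉ W) → ∃ w : M,
      (∀ q, q ∈ w ↔ ∃ u ∈ a, ∃ t ∈ X, pair t s ∈ lt ∧ q = pair u t ∧ nd true ψ t [u] ∈ W) ∧
      ∀ c ∈ a, ∀ b, nd b ψ s [c] ∈ W ↔ (b = true ↔ MSat (scons c (scons w p')) ψ) := by
    intro s hs hcons
    have : SF fun q : ((Unit × M) × M) × M => nd true ψ q.2 [q.1.2] := by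
      refine SF.nd (ts := [fun q => q.1.2]) true ψ (Prod.snd : ((Unit × M) × M) × M → M)
        fun t ht => ?_
      rw [List.mem_singleton] at ht
      subst ht
      infer_instance
    obtain ⟨w, hw⟩ := exists_sep (prod a X) fun q => ∃ u ∈ a, ∃ t ∈ X, pair t s ∈ lt ∧
      q = pair u t ∧ nd true ψ t [u] ∈ W
    have hw' : ∀ q, q ∈ w ↔ ∃ u ∈ a, ∃ t ∈ X, pair t s ∈ lt ∧ q = pair u t ∧
        nd true ψ t [u] ∈ W := by
      refine fun q => (hw q).trans (and_iff_right_of_imp ?_)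
      rintro ⟨u, hu, t, ht, -, rfl, -⟩
      exact pair_mem_prod.2 ⟨hu, ht⟩
    refine ⟨w, hw', fun c hca b => ?_⟩
    rw [sat_iff_satIn hD hψ]
    · refine evaluation_correct hc (fun b χ s l h1 h2 h3 => ?_) hs hcons hw' ψ b [c]
        (self_mem_subs ψ 1) (by simpa using haD c hca)
      rw [hW b χ s l h1 h2 h3]
      split_ifs with h <;> simp [h]
    · rintro (_ | _ | i) z hz
      · exact hD c (haD c hca) z hz
      · exact hXD z ((hw z).1 hz).1
      · exact hpD i z hz
  -- The inconsistent stages form a set, definable from `W`; at a `≺`-minimal one `hcorrect` applies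
  -- and gives a contradiction.
  have hcons : ∀ s ∈ X, ∀ u ∈ a, nd false ψ s [u] ∈ W ↔ nd true ψ s [u] ∉ W := by
    obtain ⟨B, hB⟩ := exists_sep X fun s => ∃ u ∈ a, (nd false ψ s [u] ∈ W ↔ nd true ψ s [u] ∈ W)
    by_contra! hcon
    obtain ⟨s, hs, hmin⟩ := hwf B (fun s hs => ((hB s).1 hs).1) (by
      obtain ⟨s, hs, u, hu, h⟩ := hcon
      exact ⟨s, (hB s).2 ⟨hs, u, hu, by tauto⟩⟩)
    obtain ⟨hsX, u, hu, h⟩ := (hB s).1 hs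
    obtain ⟨w, -, hw⟩ := hcorrect s hsX fun t ht hts u hu => by
      by_contra h'
      exact hmin t ((hB t).2 ⟨ht, u, hu, by tauto⟩) hts
    rw [hw u hu, hw u hu] at h
    simp at h
  obtain ⟨H, hH⟩ := exists_sep (prod a X) fun z => ∃ s ∈ X, ∃ u ∈ a, z = pair u s ∧
    nd true ψ s [u] ∈ W
  have hH' : ∀ u ∈ a, ∀ s ∈ X, pair u s ∈ H ↔ nd true ψ s [u] ∈ W := by
    intro u hu s hs
    rw [hH]
    constructor
    · rintro ⟨-, s', -, u', -, h, h'⟩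
      rw [pair_inj] at h
      rwa [h.1, h.2]
    · exact fun h => ⟨pair_mem_prod.2 ⟨hu, hs⟩, s, hs, u, hu, rfl, h⟩
  refine ⟨H, fun z hz => mem_prod.1 ((hH z).1 hz).1, fun s hs c hca => ?_⟩
  obtain ⟨w, hw, hw'⟩ := hcorrect s hs fun t ht _ => hcons t ht
  refine ⟨w, fun q => ?_, ?_⟩
  · rw [hw]
    constructor
    · rintro ⟨u, hu, t, ht, hts, rfl, h⟩
      exact ⟨t, hts, u, hu, (hH' u hu t ht).2 h, rfl⟩
    · rintro ⟨t, hts, u, hu, h, rfl⟩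
      have ht := (pair_mem_prod.1 ((hH _).1 h).1).2
      exact ⟨u, hu, t, ht, hts, rfl, (hH' u hu t ht).1 h⟩
  · rw [hH' c hca s hs, hw' c hca, hp']
    simp

end Recursion

/-! ### From models back to derivations -/

theorem fvBound_of_mem_theoryC {φ : Fml} (h : φ ∈ theoryC) : fvBound φ = 0 := by
  simp only [theoryC, theoryB, Set.mem_union, Set.mem_insert_iff, Set.mem_singleton_iff,
    Set.mem_ofPred_eq] at h
  obtain ((rfl | rfl | rfl | rfl | rfl | rfl | rfl) | ⟨φ, -, rfl⟩) | rfl := h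
  on_goal 8 => exact fvBound_univClosure _
  all_goals simp [fvBound, axExtensionality, axPair, axUnion, axInfinity, axRegularity,
    axTransitiveClosure, axFinitePowerset, axBeta, biimp, conj, disj, neg, ex, allIn, exIn,
    isUPair, isPair, pairMem, isLimit, isOrd, isTransitive, subset, isWF, isRel, isFun,
    isFinite, isNat, isZeroOrSucc, isBij]

theorem sat_transRec {M : Type} [ModelC M] {ψ : Fml} (hψ : IsDelta0 ψ) (hc : OnlyAsClass 1 ψ)
    {χ : Fml} (hχ : χ = transRec ψ) : ∀ v : ℕ → M, Sat ModelC.E v χ := by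
  unfold transRec at hχ
  rw [hχ]
  rw [sat_univClosure]
  intro p a X lt
  simp only [Sat, sat_isWF, scons_zero, scons_succ]
  rintro ⟨-, hwf⟩
  obtain ⟨H, h1, h2⟩ := exists_recursion (a := a) hψ hc p hwf
  rw [sat_ex]
  refine ⟨H, ?_⟩
  rw [sat_conj, sat_isRel, sat_allIn]
  refine ⟨h1, fun s hs c hca => ?_⟩
  obtain ⟨w, hw, hw'⟩ := h2 s hs c hca
  rw [sat_ex]
  refine ⟨w, ?_⟩
  rw [sat_conj, sat_biimp, sat_pairMem, sat_rename]
  constructor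
  · intro q
    rw [sat_biimp]
    refine (hw q).trans ?_
    simp [mE]
  · refine hw'.trans (Sat.congr fun i _ => ?_)
    match i with
    | 0 => rfl
    | 1 => rfl
    | i + 2 => rfl

end SetTh

theorem mainTheorem1 (χ : SetTh.Fml) (hχ : χ ∈ SetTh.delta0TR) :
    SetTh.Derives SetTh.theoryC χ := by
  obtain ⟨ψ, hψ, hc, hχ⟩ := hχ
  refine SetTh.derives_of_valid (fun φ hφ => SetTh.fvBound_of_mem_theoryC hφ) fun M E hne hM => ?_
  let I : SetTh.ModelC M := ⟨E, hne, hM⟩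
  exact SetTh.sat_transRec hψ hc hχ
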